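/- Let $a>0$, $b>0$ and $L>0$. Let $X_0=L^2(0,L)\times L^2(0,L)$ (real-valued functions) with its usual inner product $\big((\theta,v),(\eta,u)\big)_{X_0}=\int_0^L(\theta\eta+vu)\,dx$. Let $H^k(0,L)$ denote the usual Sobolev spaces, let $H^2_0(0,L)=\{f\in H^2(0,L): f(0)=f(L)=f_x(0)=f_x(L)=0\}$, and put $$\overline{X}_5=\{(\varphi,\psi)\in[H^5(0,L)\cap H^2_0(0,L)]^2:\ \varphi_{xx}(0)=\psi_{xx}(L)=0\},$$ where boundary values are understood in the sense of traces. Let $\widetilde A$ be the unbounded operator on $X_0$ with domain $D(\widetilde A)=\overline{X}_5$ given by $$\widetilde A(\varphi,\psi)=\big(-\psi_x+a\psi_{xxx}-b\psi_{xxxxx},\ -\varphi_x+a\varphi_{xxx}-b\varphi_{xxxxx}\big).$$ Then $\widetilde A$ is skew-adjoint in $X_0$, that is, $\widetilde A$ is densely defined and $\widetilde A^*=-\widetilde A$ (with $D(\widetilde A^*)=D(\widetilde A)$). Moreover, $\widetilde A$ is the infinitesimal generator of a strongly continuous group $(e^{t\widetilde A})_{t\in\mathbb{R}}$ of linear isometries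 of $X_0$. -/

import Mathlib

open MeasureTheory Set Filter Topology
open scoped ContDiff

noncomputable section

namespace Boussinesq

/-! ### Sobolev spaces on the interval `(0, L)` -/

/-- Lebesgue measure on the interval `(0, L)`. -/
abbrev intervalMeasure (L : ℝ) : Measure ℝ := volume.restrict (Ioo 0 L)

/-- The real Hilbert space `L²(0, L)`. -/
abbrev L2 (L : ℝ) : Type := Lp ℝ 2 (intervalMeasure L)

/-- `φ ∈ C_c^∞(0, L)`. -/
def IsTestFunction (L : ℝ) (φ : ℝ → ℝ) : Prop :=
  ContDiff ℝ ∞ φ ∧ HasCompactSupport φ ∧ tsupport φ ⊆ Ioo 0 L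

/-- `g ∈ L²(0, L)` is the `k`-th weak (distributional) derivative of `f ∈ L²(0, L)`. -/
def IsWeakDeriv (L : ℝ) (k : ℕ) (f g : L2 L) : Prop :=
  ∀ φ : ℝ → ℝ, IsTestFunction L φ →
    ∫ x in Ioo 0 L, f x * iteratedDeriv k φ x = (-1) ^ k * ∫ x in Ioo 0 L, g x * φ x

lemma IsTestFunction.iteratedDeriv {L : ℝ} {φ : ℝ → ℝ} (h : IsTestFunction L φ) (k : ℕ) :
    Continuous (iteratedDeriv k φ) ∧ HasCompactSupport (iteratedDeriv k φ) := by
  refine ⟨h.1.continuous_iteratedDeriv k (by exact_mod_cast le_top), ?_⟩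
  induction k with
  | zero => simpa using h.2.1
  | succ k ih => rw [iteratedDeriv_succ]; exact ih.deriv

lemma integrable_mul {L : ℝ} (f : L2 L) {ψ : ℝ → ℝ} (h : Continuous ψ ∧ HasCompactSupport ψ) :
    Integrable (fun x => f x * ψ x) (intervalMeasure L) :=
  (Lp.memLp f).integrable_mul 
    (show MemLp ψ 2 (intervalMeasure L) from h.1.memLp_of_hasCompactSupport h.2)

lemma integral_zero_mul (L : ℝ) (ψ : ℝ → ℝ) : ∫ x in Ioo 0 L, (0 : L2 L) x * ψ x = 0 := by
  rw [integral_congr_ae (g := fun _ => (0 : ℝ))]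
  · simp
  · filter_upwards [Lp.coeFn_zero ℝ 2 (intervalMeasure L)] with x hx
    rw [hx, Pi.zero_apply, zero_mul]

lemma IsWeakDeriv.zero (L : ℝ) (k : ℕ) : IsWeakDeriv L k 0 0 := by
  intro φ _
  rw [integral_zero_mul, integral_zero_mul, mul_zero]

lemma IsWeakDeriv.add {L : ℝ} {k : ℕ} {f₁ f₂ g₁ g₂ : L2 L} (h₁ : IsWeakDeriv L k f₁ g₁)
    (h₂ : IsWeakDeriv L k f₂ g₂) : IsWeakDeriv L k (f₁ + f₂) (g₁ + g₂) := by
  intro φ hφ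
  have key : ∀ (u v : L2 L) (ψ : ℝ → ℝ), Continuous ψ ∧ HasCompactSupport ψ →
      ∫ x in Ioo 0 L, (u + v : L2 L) x * ψ x
        = (∫ x in Ioo 0 L, u x * ψ x) + ∫ x in Ioo 0 L, v x * ψ x := by
    intro u v ψ hψ
    rw [← integral_add (integrable_mul u hψ) (integrable_mul v hψ)]
    refine integral_congr_ae ?_
    filter_upwards [Lp.coeFn_add u v] with x hx
    rw [hx, Pi.add_apply, add_mul]
  rw [key _ _ _ (hφ.iteratedDeriv k), key _ _ _ ⟨hφ.1.continuous, hφ.2.1⟩, h₁ φ hφ, h₂ φ hφ, mul_add]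

lemma IsWeakDeriv.smul {L : ℝ} {k : ℕ} {f g : L2 L} (c : ℝ) (h : IsWeakDeriv L k f g) :
    IsWeakDeriv L k (c • f) (c • g) := by
  intro φ hφ
  have key : ∀ (u : L2 L) (ψ : ℝ → ℝ),
      ∫ x in Ioo 0 L, (c • u : L2 L) x * ψ x = c * ∫ x in Ioo 0 L, u x * ψ x := by
    intro u ψ
    rw [← integral_const_mul]
    refine integral_congr_ae ?_
    filter_upwards [Lp.coeFn_smul c u] with x hx
    rw [hx, Pi.smul_apply, smul_eq_mul, mul_assoc]
  rw [key, key, h φ hφ]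
  ring

/-- Weak derivatives are unique. -/
lemma IsWeakDeriv.unique {L : ℝ} {k : ℕ} {f g₁ g₂ : L2 L} (h₁ : IsWeakDeriv L k f g₁)
    (h₂ : IsWeakDeriv L k f g₂) : g₁ = g₂ := by
  have h := h₁.add (h₂.smul (-1))
  have hf : f + (-1 : ℝ) • f = 0 := by simp
  rw [hf] at h
  set d : L2 L := g₁ + (-1 : ℝ) • g₂ with hd
  have hint : Integrable d (intervalMeasure L) := (Lp.memLp d).integrable (by norm_num)
  have hz : ∀ᵐ x ∂(volume : Measure ℝ), x ∈ Ioo 0 L → d x = 0 := by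
    refine isOpen_Ioo.ae_eq_zero_of_integral_contDiff_smul_eq_zero
      (IntegrableOn.locallyIntegrableOn hint) ?_
    intro φ h1 h2 h3
    have e := (h φ ⟨h1, h2, h3⟩).symm.trans (IsWeakDeriv.zero L k φ ⟨h1, h2, h3⟩)
    rw [integral_zero_mul, mul_zero] at e
    have e1 : ∫ x in Ioo 0 L, d x * φ x = 0 := by
      rcases mul_eq_zero.1 e with e | e
      · exact absurd e (pow_ne_zero _ (by norm_num))
      · exact e
    rw [← setIntegral_eq_integral_of_forall_compl_eq_zero (s := Ioo 0 L)]
    · simpa only [smul_eq_mul, mul_comm] using e1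
    · intro x hx
      rw [image_eq_zero_of_notMem_tsupport (fun hx' => hx (h3 hx')), zero_smul]
  have hd0 : d = 0 := by
    refine Lp.ext ?_
    filter_upwards [(ae_restrict_iff' measurableSet_Ioo).2 hz,
      Lp.coeFn_zero ℝ 2 (intervalMeasure L)] with x h1 h2
    rw [h1, h2]; rfl
  rw [hd] at hd0
  simpa [← sub_eq_add_neg, sub_eq_zero] using hd0

/-- The Sobolev space `H^k(0, L)`: the elements of `L²(0, L)` whose weak derivatives of order up to
`k` exist in `L²(0, L)`. -/
def sobolev (L : ℝ) (k : ℕ) : Submodule ℝ (L2 L) where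
  carrier := {f | ∀ j ≤ k, ∃ g, IsWeakDeriv L j f g}
  zero_mem' := fun j _ => ⟨0, IsWeakDeriv.zero L j⟩
  add_mem' := fun hf hg j hj => by
    obtain ⟨u, hu⟩ := hf j hj
    obtain ⟨v, hv⟩ := hg j hj
    exact ⟨u + v, hu.add hv⟩
  smul_mem' := fun c f hf j hj => by
    obtain ⟨u, hu⟩ := hf j hj
    exact ⟨c • u, hu.smul c⟩

open Classical in
/-- The `k`-th weak derivative of `f` (the value `0` is used if there is none in `L²(0, L)`). -/
def weakDeriv (L : ℝ) (k : ℕ) (f : L2 L) : L2 L :=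
  if h : ∃ g, IsWeakDeriv L k f g then h.choose else 0

lemma IsWeakDeriv.weakDeriv_eq {L : ℝ} {k : ℕ} {f g : L2 L} (h : IsWeakDeriv L k f g) :
    weakDeriv L k f = g := by
  have hex : ∃ g, IsWeakDeriv L k f g := ⟨g, h⟩
  rw [weakDeriv, dif_pos hex]
  exact hex.choose_spec.unique h

lemma isWeakDeriv_weakDeriv {L : ℝ} {k j : ℕ} {f : L2 L} (hf : f ∈ sobolev L k) (hj : j ≤ k) :
    IsWeakDeriv L j f (weakDeriv L j f) := by
  obtain ⟨g, hg⟩ := hf j hj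
  rwa [hg.weakDeriv_eq]

lemma weakDeriv_zero (L : ℝ) (k : ℕ) : weakDeriv L k 0 = 0 := (IsWeakDeriv.zero L k).weakDeriv_eq

lemma weakDeriv_add {L : ℝ} {k j : ℕ} {f g : L2 L} (hf : f ∈ sobolev L k) (hg : g ∈ sobolev L k)
    (hj : j ≤ k) : weakDeriv L j (f + g) = weakDeriv L j f + weakDeriv L j g :=
  ((isWeakDeriv_weakDeriv hf hj).add (isWeakDeriv_weakDeriv hg hj)).weakDeriv_eq

lemma weakDeriv_smul {L : ℝ} {k j : ℕ} {f : L2 L} (c : ℝ) (hf : f ∈ sobolev L k) (hj : j ≤ k) :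
    weakDeriv L j (c • f) = c • weakDeriv L j f :=
  ((isWeakDeriv_weakDeriv hf hj).smul c).weakDeriv_eq

/-- `f ∈ L²(0, L)` has a representative that is continuous on `[0, L]` and vanishes at
`p ∈ {0, L}`. For `f ∈ H¹(0, L)` this says that the trace `f(p)` is zero. -/
def TraceZero (L p : ℝ) (f : L2 L) : Prop :=
  ∃ r : ℝ → ℝ, ContinuousOn r (Icc 0 L) ∧ f =ᵐ[intervalMeasure L] r ∧ r p = 0

lemma TraceZero.zero (L p : ℝ) : TraceZero L p 0 :=
  ⟨fun _ => 0, continuousOn_const, Lp.coeFn_zero ℝ 2 (intervalMeasure L), rfl⟩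

lemma TraceZero.add {L p : ℝ} {f g : L2 L} (hf : TraceZero L p f) (hg : TraceZero L p g) :
    TraceZero L p (f + g) := by
  obtain ⟨r, hr, hfr, hrp⟩ := hf
  obtain ⟨s, hs, hgs, hsp⟩ := hg
  refine ⟨fun x => r x + s x, hr.add hs, ?_, by simp [hrp, hsp]⟩
  filter_upwards [hfr, hgs, Lp.coeFn_add f g] with x h1 h2 h3
  rw [h3, Pi.add_apply, h1, h2]

lemma TraceZero.smul {L p : ℝ} {f : L2 L} (c : ℝ) (hf : TraceZero L p f) :
    TraceZero L p (c • f) := by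
  obtain ⟨r, hr, hfr, hrp⟩ := hf
  refine ⟨fun x => c * r x, continuousOn_const.mul hr, ?_, by simp [hrp]⟩
  filter_upwards [hfr, Lp.coeFn_smul c f] with x h1 h3
  rw [h3, Pi.smul_apply, smul_eq_mul, h1]

/-- The functions in `H^m(0, L)` whose `k`-th derivative, `k ≤ m`, has zero trace at `p`. -/
def sobolevTraceZero (L : ℝ) (m k : ℕ) (hk : k ≤ m) (p : ℝ) : Submodule ℝ (L2 L) where
  carrier := {f | f ∈ sobolev L m ∧ TraceZero L p (weakDeriv L k f)}
  zero_mem' := ⟨zero_mem _, by rw [weakDeriv_zero]; exact TraceZero.zero L p⟩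
  add_mem' := fun hf hg => ⟨add_mem hf.1 hg.1, by
    rw [weakDeriv_add hf.1 hg.1 hk]; exact hf.2.add hg.2⟩
  smul_mem' := fun c _ hf => ⟨Submodule.smul_mem _ c hf.1, by
    rw [weakDeriv_smul c hf.1 hk]; exact hf.2.smul c⟩

/-- `H²_0(0, L) = {f ∈ H²(0, L) : f(0) = f(L) = f_x(0) = f_x(L) = 0}`. -/
def sobolevTwoZero (L : ℝ) : Submodule ℝ (L2 L) :=
  sobolevTraceZero L 2 0 (by norm_num) 0 ⊓ sobolevTraceZero L 2 0 (by norm_num) L ⊓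
    (sobolevTraceZero L 2 1 (by norm_num) 0 ⊓ sobolevTraceZero L 2 1 (by norm_num) L)

/-! ### The operator -/

/-- The real Hilbert space `L²(0, L) × L²(0, L)`, with
`⟪(θ, v), (η, u)⟫ = ∫ θ η + ∫ v u`. -/
abbrev X0 (L : ℝ) : Type := WithLp 2 (L2 L × L2 L)

/-- The space of pairs `(φ, ψ) ∈ [H⁵(0, L) ∩ H²_0(0, L)]²` with `φ_xx(0) = ψ_xx(L) = 0`. -/
def X5 (L : ℝ) : Submodule ℝ (X0 L) :=
  (((sobolev L 5 ⊓ sobolevTwoZero L ⊓ sobolevTraceZero L 5 2 (by norm_num) 0).prod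
    (sobolev L 5 ⊓ sobolevTwoZero L ⊓ sobolevTraceZero L 5 2 (by norm_num) L))).comap
      (WithLp.linearEquiv 2 ℝ (L2 L × L2 L)).toLinearMap

/-- The differential operator `w ↦ -w_x + a w_xxx - b w_xxxxx` on `H⁵(0, L)`. -/
def diffOp (a b L : ℝ) : sobolev L 5 →ₗ[ℝ] L2 L where
  toFun w := -weakDeriv L 1 (w : L2 L) + a • weakDeriv L 3 (w : L2 L) - b • weakDeriv L 5 (w : L2 L)
  map_add' v w := by
    simp only [Submodule.coe_add]
    rw [weakDeriv_add v.2 w.2 (by norm_num), weakDeriv_add v.2 w.2 (by norm_num),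
      weakDeriv_add v.2 w.2 (by norm_num)]
    module
  map_smul' c w := by
    simp only [Submodule.coe_smul, RingHom.id_apply]
    rw [weakDeriv_smul c w.2 (by norm_num), weakDeriv_smul c w.2 (by norm_num),
      weakDeriv_smul c w.2 (by norm_num)]
    module

/-- The unbounded operator
`(φ, ψ) ↦ (-ψ_x + a ψ_xxx - b ψ_xxxxx, -φ_x + a φ_xxx - b φ_xxxxx)` with domain `X5 L`. -/
def opA (a b L : ℝ) : X0 L →ₗ.[ℝ] X0 L where
  domain := X5 L
  toFun :=
    { toFun := fun w => WithLp.toLp 2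
        (diffOp a b L ⟨(w : X0 L).snd, w.2.2.1.1⟩, diffOp a b L ⟨(w : X0 L).fst, w.2.1.1.1⟩)
      map_add' := fun v w => by
        rw [← WithLp.toLp_add, Prod.mk_add_mk, ← map_add, ← map_add]
        rfl
      map_smul' := fun c w => by
        rw [RingHom.id_apply, ← WithLp.toLp_smul, Prod.smul_mk, ← map_smul, ← map_smul]
        rfl }

/-! ### Skew-adjoint operators and groups of isometries -/

/-- A densely defined operator `A` on a Hilbert space with `A* = -A` (equality of domains
included). -/
def IsSkewAdjointOp {X : Type*} [NormedAddCommGroup X] [InnerProductSpace ℝ X] [CompleteSpace X]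
    (A : X →ₗ.[ℝ] X) : Prop :=
  Dense (A.domain : Set X) ∧ A.adjoint = -A

/-- A strongly continuous group (`C₀`-group) of bounded linear operators. -/
structure C0Group (X : Type*) [NormedAddCommGroup X] [NormedSpace ℝ X] where
  /-- The operator at time `t`. -/
  toFun : ℝ → X →L[ℝ] X
  map_zero : toFun 0 = ContinuousLinearMap.id ℝ X
  map_add : ∀ s t, toFun (s + t) = (toFun s).comp (toFun t)
  continuous_orbit : ∀ x, Continuous fun t => toFun t x

/-- `A` is the infinitesimal generator of the group `G`: `x ∈ D(A)` and `A x = y` if and only if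
`(G(t) x - x) / t → y` as `t → 0`. -/
def C0Group.IsGenerator {X : Type*} [NormedAddCommGroup X] [NormedSpace ℝ X] (G : C0Group X)
    (A : X →ₗ.[ℝ] X) : Prop :=
  ∀ x y : X, (x, y) ∈ A.graph ↔
    Tendsto (fun t : ℝ => t⁻¹ • (G.toFun t x - x)) (𝓝[≠] 0) (𝓝 y)

/-- `A` generates a `C₀`-group of isometries. -/
def GeneratesIsometryGroup {X : Type*} [NormedAddCommGroup X] [NormedSpace ℝ X]
    (A : X →ₗ.[ℝ] X) : Prop :=
  ∃ G : C0Group X, G.IsGenerator A ∧ ∀ t, Isometry (G.toFun t)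

end Boussinesq

end

noncomputable section

namespace Boussinesq

section Abstract

variable {X : Type*} [NormedAddCommGroup X] [InnerProductSpace ℝ X] [CompleteSpace X]

/-! ### Skew-symmetric surjective operators -/

/-! Everything follows from two properties of the operator: it is skew-symmetric and it is onto.
Surjectivity forces the domain to be dense and leaves no room for a larger adjoint domain. It also
gives a bounded skew-adjoint inverse `T`. The group is built from `T` alone: the bounded skew
operators `B = -T (ε - T²)⁻¹`, formally `A (1 - εA²)⁻¹`, commute and tend to `A` on the dense range
of `T³`. Hence the isometries `exp (tB)` converge strongly as `ε → 0`, and the limit group has `A`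
as its generator (`exists_skew_approx`, `exists_isometryGroup_of_inverse`).

Let `D w = -w' + a w''' - b w⁽⁵⁾`. Skew-symmetry (`inner_diffOp`) is integration by parts with
absolutely continuous representatives of the weak derivatives. The `H²_0` conditions leave only the
boundary term in `φ'' ψ''`, and this vanishes at both ends since `φ''(0) = 0` and `ψ''(L) = 0`.

Since the operator swaps components, surjectivity (`exists_diffOp_eq`) reduces to solving `D w = f`
with `w, w'` zero at both ends and `w''` zero at one end `p`. Integrating once gives a fourth-order
equation with continuous forcing and a free constant. Shooting from `p` leaves two unknowns,
`w'''(p)` and that constant, and two conditions at the other end `q`. Thus uniqueness implies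
existence, and uniqueness comes from the multiplier `(x - q) w` (`IsSolution.eq_zero_of_boundary`).
-/

theorem dense_domain_of_skewSymmetric_of_surjective (A : X →ₗ.[ℝ] X)
    (hs : ∀ x y : A.domain, inner ℝ (A x) (y : X) = -inner ℝ (x : X) (A y))
    (hA : ∀ z, ∃ x : A.domain, A x = z) : Dense (A.domain : Set X) := by
  rw [Submodule.dense_iff_topologicalClosure_eq_top, Submodule.topologicalClosure_eq_top_iff,
    Submodule.eq_bot_iff]
  intro y hy
  obtain ⟨w, rfl⟩ := hA y
  have hw : (w : X) = 0 := by
    -- With `y = A w` orthogonal to the domain and `A v = w`, one gets `⟨w, w⟩ = ⟨A v, w⟩ = -⟨v, A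
    -- w⟩ = 0`.
    obtain ⟨v, hv⟩ := hA w
    have h1 := hs v w
    rw [hv, (Submodule.mem_orthogonal _ _).1 hy v v.2] at h1
    rw [← inner_self_eq_zero (𝕜 := ℝ)]
    simpa using h1
  have : w = 0 := Subtype.ext hw
  simp [this]

theorem isSkewAdjointOp_of_skewSymmetric_of_surjective (A : X →ₗ.[ℝ] X)
    (hs : ∀ x y : A.domain, inner ℝ (A x) (y : X) = -inner ℝ (x : X) (A y))
    (hA : ∀ z, ∃ x : A.domain, A x = z) : IsSkewAdjointOp A := by
  have hd := dense_domain_of_skewSymmetric_of_surjective A hs hA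
  have hform : A.IsFormalAdjoint (-A) := fun x y => by
    rw [LinearPMap.neg_apply, inner_neg_right]; exact hs x y
  refine ⟨hd, (LinearPMap.eq_of_le_of_domain_eq (hform.le_adjoint hd)
    (le_antisymm (hform.le_adjoint hd).1 ?_)).symm⟩
  intro y hy
  -- Since `-A` is contained in the adjoint, `y - w` is orthogonal to the range of `A`, which is the
  -- whole space.
  obtain ⟨w, hw⟩ := hA (-(A.adjoint ⟨y, hy⟩))
  have key : y = w := by
    rw [← sub_eq_zero, ← inner_self_eq_zero (𝕜 := ℝ)]
    obtain ⟨x, hx⟩ := hA (y - w)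
    nth_rw 2 [← hx]
    rw [inner_sub_left, ← LinearPMap.adjoint_isFormalAdjoint hd ⟨y, hy⟩ x]
    have h1 := hs w x
    rw [hw, inner_neg_left] at h1
    linarith
  rw [key]
  exact w.2

theorem exists_skew_inverse (A : X →ₗ.[ℝ] X)
    (hs : ∀ x y : A.domain, inner ℝ (A x) (y : X) = -inner ℝ (x : X) (A y))
    (hA : ∀ z, ∃ x : A.domain, A x = z) :
    ∃ T : X →L[ℝ] X, star T = -T ∧ ∀ x y, (x, y) ∈ A.graph ↔ x = T y := by
  have hinj : ∀ x : A.domain, A x = 0 → x = 0 := by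
    intro x hx
    obtain ⟨v, hv⟩ := hA x
    have h1 := hs x v
    rw [hx, hv, inner_zero_left] at h1
    refine Subtype.ext ?_
    rw [Submodule.coe_zero, ← inner_self_eq_zero (𝕜 := ℝ)]
    linarith
  have hinj' : Function.Injective A := by
    intro x y hxy
    rw [← sub_eq_zero]
    apply hinj
    rw [LinearPMap.map_sub, hxy, sub_self]
  choose S hS using hA
  let T₀ : X →ₗ[ℝ] X :=
    { toFun := fun z => S z
      map_add' := fun z w => by
        rw [← Submodule.coe_add]
        congr 1
        apply hinj'
        rw [LinearPMap.map_add, hS, hS, hS]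
      map_smul' := fun c z => by
        rw [RingHom.id_apply, ← Submodule.coe_smul]
        congr 1
        apply hinj'
        rw [LinearPMap.map_smul, hS, hS] }
  have hskew : ∀ z w, inner ℝ (T₀ z) w = -inner ℝ z (T₀ w) := by
    intro z w
    have h1 := hs (S z) (S w)
    rw [hS, hS] at h1
    change inner ℝ (S z : X) w = -inner ℝ z (S w : X)
    linarith
  -- Hellinger–Toeplitz: an everywhere defined skew-symmetric map has closed graph, hence is
  -- bounded.
  have hcont : Continuous T₀ := by
    refine T₀.continuous_of_seq_closed_graph fun u x y hu hTu => ?_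
    rw [← sub_eq_zero, ← inner_self_eq_zero (𝕜 := ℝ)]
    have h1 : Tendsto (fun n => inner ℝ (T₀ (u n) - T₀ x) (y - T₀ x)) atTop
        (𝓝 (inner ℝ (y - T₀ x) (y - T₀ x))) := (hTu.sub_const _).inner tendsto_const_nhds
    have h2 : Tendsto (fun n => -inner ℝ (u n - x) (T₀ (y - T₀ x))) atTop
        (𝓝 (-inner ℝ (x - x) (T₀ (y - T₀ x)))) :=
      ((hu.sub_const _).inner tendsto_const_nhds).neg
    simp only [← hskew, map_sub T₀ _ x] at h2
    rw [tendsto_nhds_unique h1 (by simpa only [map_sub] using h2)]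
    simp
  refine ⟨⟨T₀, hcont⟩, ?_, ?_⟩
  · rw [ContinuousLinearMap.star_eq_adjoint]
    symm
    rw [ContinuousLinearMap.eq_adjoint_iff]
    intro x y
    change inner ℝ (-(T₀ x)) y = inner ℝ x (T₀ y)
    rw [inner_neg_left, hskew, neg_neg]
  · intro x y
    rw [LinearPMap.mem_graph_iff]
    constructor
    · rintro ⟨v, hv, hv'⟩
      change x = S y
      have : v = S y := hinj' (by rw [hS]; exact hv')
      rw [← this]; exact hv.symm
    · intro h
      exact ⟨S y, h.symm, hS y⟩

/-! ### Bounded skew-adjoint operators -/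

theorem inner_apply_of_star_eq_neg {T : X →L[ℝ] X} (hT : star T = -T) (x y : X) :
    inner ℝ (T x) y = -inner ℝ x (T y) := by
  rw [← ContinuousLinearMap.adjoint_inner_right, ← ContinuousLinearMap.star_eq_adjoint, hT]
  simp

theorem dense_range_of_skew_of_injective {T : X →L[ℝ] X} (hT : star T = -T)
    (hinj : ∀ y, T y = 0 → y = 0) : DenseRange T := by
  have : Dense ((LinearMap.range T.toLinearMap : Submodule ℝ X) : Set X) := by
    rw [Submodule.dense_iff_topologicalClosure_eq_top, Submodule.topologicalClosure_eq_top_iff,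
      Submodule.eq_bot_iff]
    intro y hy
    apply hinj
    have h : inner ℝ y (T (T y)) = 0 := (Submodule.mem_orthogonal' _ _).1 hy _ ⟨T y, rfl⟩
    rw [← inner_self_eq_zero (𝕜 := ℝ), inner_apply_of_star_eq_neg hT, h, neg_zero]
  rw [LinearMap.coe_range] at this
  exact this

theorem norm_exp_skew_apply {B : X →L[ℝ] X} (hB : star B = -B) (t : ℝ) (x : X) :
    ‖NormedSpace.exp (t • B) x‖ = ‖x‖ := by
  let _ : NormedAlgebra ℚ (X →L[ℝ] X) := NormedAlgebra.restrictScalars ℚ ℝ _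
  have h1 : t • B ∈ skewAdjoint (X →L[ℝ] X) := by
    rw [skewAdjoint.mem_iff, star_smul, hB, star_trivial, smul_neg]
  have h2 : NormedSpace.exp (t • B) ∈ unitary (X →L[ℝ] X) :=
    NormedSpace.exp_mem_unitary_of_mem_skewAdjoint h1
  exact ContinuousLinearMap.norm_map_of_mem_unitary h2 x

theorem hasDerivAt_exp_smul_apply (B : X →L[ℝ] X) (x : X) (t : ℝ) :
    HasDerivAt (fun s : ℝ => NormedSpace.exp (s • B) x) (NormedSpace.exp (t • B) (B x)) t := by
  have := (hasDerivAt_exp_smul_const (𝕂 := ℝ) B t).clm_apply (hasDerivAt_const t x)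
  simpa using this

theorem exp_add_smul (B : X →L[ℝ] X) (s t : ℝ) :
    NormedSpace.exp ((s + t) • B) = NormedSpace.exp (s • B) * NormedSpace.exp (t • B) := by
  let _ : NormedAlgebra ℚ (X →L[ℝ] X) := NormedAlgebra.restrictScalars ℚ ℝ _
  rw [add_smul]
  exact NormedSpace.exp_add_of_commute (((Commute.refl B).smul_left s).smul_right t)

theorem norm_exp_skew_apply_sub_le {B : X →L[ℝ] X} (hB : star B = -B) (s t : ℝ) (x : X) :
    ‖NormedSpace.exp (t • B) x - NormedSpace.exp (s • B) x‖ ≤ ‖B x‖ * |t - s| := by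
  have := convex_univ.norm_image_sub_le_of_norm_hasDerivWithin_le (𝕜 := ℝ) (x := s) (y := t)
    (fun r _ => (hasDerivAt_exp_smul_apply B x r).hasDerivWithinAt)
    (fun r _ => (norm_exp_skew_apply hB r (B x)).le) (mem_univ _) (mem_univ _)
  simpa using this

/-- Commutation gives `exp (tB) = exp (tC) exp (t(B - C))`. The isometry `exp (tC)` drops out,
leaving the mean value bound for the skew operator `B - C`. -/
theorem norm_exp_skew_sub_exp_skew_le {B C : X →L[ℝ] X} (hB : star B = -B) (hC : star C = -C)
    (hBC : Commute B C) (t : ℝ) (x : X) :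
    ‖NormedSpace.exp (t • B) x - NormedSpace.exp (t • C) x‖ ≤ ‖B x - C x‖ * |t| := by
  let _ : NormedAlgebra ℚ (X →L[ℝ] X) := NormedAlgebra.restrictScalars ℚ ℝ _
  have hsk : star (B - C) = -(B - C) := by rw [star_sub, hB, hC]; abel
  have h1 : NormedSpace.exp (t • B)
      = NormedSpace.exp (t • C) * NormedSpace.exp (t • (B - C)) := by
    rw [← NormedSpace.exp_add_of_commute]
    · rw [← smul_add, add_sub_cancel]
    · exact ((hBC.symm.sub_right (Commute.refl C)).smul_left t).smul_right t
  rw [h1, mul_apply_eq_comp, ← map_sub, norm_exp_skew_apply hC]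
  have := norm_exp_skew_apply_sub_le hsk 0 t x
  simpa using this

/-- A Yosida-type regularisation of `T⁻¹`, obtained without inverting `T`: `K = ε - T²` is coercive
because `⟨K x, x⟩ = ε‖x‖² + ‖T x‖²`. With `R = K⁻¹`, the operator `-T R` is skew and commutes with
whatever commutes with `T`. -/
theorem exists_skew_approx {T : X →L[ℝ] X} (hT : star T = -T) {ε : ℝ} (hε : 0 < ε) :
    ∃ B : X →L[ℝ] X, star B = -B ∧ (∀ S, Commute S T → Commute S B) ∧
      ∀ z, ‖B (T (T (T z))) - T (T z)‖ ≤ 2 * ε * ‖z‖ := by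
  set K : X →L[ℝ] X := ε • 1 - T * T with hK
  have hinner : ∀ x, ε * ‖x‖ ^ 2 ≤ inner ℝ (K x) x := by
    intro x
    have : inner ℝ (K x) x = ε * ‖x‖ ^ 2 + ‖T x‖ ^ 2 := by
      rw [hK]
      simp only [_root_.sub_apply, _root_.smul_apply,
        one_apply_eq_self, mul_apply_eq_comp, inner_sub_left,
        inner_smul_left, inner_apply_of_star_eq_neg hT (T x) x, real_inner_self_eq_norm_sq]
      simp
    rw [this]
    nlinarith [sq_nonneg ‖T x‖]
  have hunit : IsUnit K := by
    refine K.isUnit_of_forall_le_norm_inner_map (c := ⟨ε, hε.le⟩) hε fun x => ?_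
    rw [mul_comm]
    exact (hinner x).trans (le_abs_self _)
  set R := Ring.inverse K with hR
  have hKR : K * R = 1 := Ring.mul_inverse_cancel K hunit
  have hcomm : ∀ S, Commute S T → Commute S R := by
    intro S hS
    have h1 : Commute S K :=
      ((Commute.one_right S).smul_right ε).sub_right (hS.mul_right hS)
    have hRK : R * K = 1 := Ring.inverse_mul_cancel K hunit
    calc S * R = R * K * S * R := by rw [hRK, one_mul]
      _ = R * (S * K) * R := by rw [h1.eq]; simp only [mul_assoc]
      _ = R * S := by rw [mul_assoc, mul_assoc, hKR, mul_one]
  have hTR := hcomm T (Commute.refl T)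
  have hstarK : star K = K := by
    rw [hK, star_sub, star_mul, hT, star_smul, star_one]; simp
  have hstarR : star R = R := by rw [hR, ← Ring.inverse_star, hstarK]
  have hRn : ∀ z, ε * ‖R z‖ ≤ ‖z‖ := by
    intro z
    have h1 := hinner (R z)
    have h2 : K (R z) = z := by
      rw [← mul_apply_eq_comp, hKR, one_apply_eq_self]
    rw [h2] at h1
    have h3 := real_inner_le_norm z (R z)
    rcases (norm_nonneg (R z)).eq_or_lt with h | h
    · rw [← h, mul_zero]; exact norm_nonneg z
    · nlinarith
  have hform : ∀ z, T (T (R z)) = ε • R z - z := by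
    intro z
    have h2 : K (R z) = z := by
      rw [← mul_apply_eq_comp, hKR, one_apply_eq_self]
    nth_rw 3 [← h2]
    simp [hK]
  have hTRa : ∀ z, R (T z) = T (R z) := fun z => by
    rw [← mul_apply_eq_comp, ← hTR.eq, mul_apply_eq_comp]
  refine ⟨-(T * R), ?_, fun S hS => (hS.mul_right (hcomm S hS)).neg_right, fun z => ?_⟩
  · rw [star_neg, star_mul, hT, hstarR, mul_neg, hTR.eq]
  -- Two applications of `T² R = εR - 1`; the bound then uses `ε‖R z‖ ≤ ‖z‖`.
  · have e : (-(T * R)) (T (T (T z))) - T (T z) = ε • (z - ε • R z) := by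
      simp only [_root_.neg_apply, mul_apply_eq_comp, hTRa, hform,
        map_sub, map_smul]
      module
    rw [e, norm_smul, Real.norm_eq_abs, abs_of_pos hε]
    have h1 : ‖z - ε • R z‖ ≤ ‖z‖ + ‖z‖ := by
      refine (norm_sub_le _ _).trans (add_le_add le_rfl ?_)
      rw [norm_smul, Real.norm_eq_abs, abs_of_pos hε]
      exact hRn z
    nlinarith

end Abstract

section Abstract

variable {X : Type*} [NormedAddCommGroup X] [InnerProductSpace ℝ X]

/-! ### The group generated by the inverse of an injective bounded skew-adjoint operator -/

theorem continuous_of_dense_of_norm_map {U : ℝ → X →L[ℝ] X} (hU : ∀ t x, ‖U t x‖ = ‖x‖)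
    {D : Set X} (hD : Dense D) (hc : ∀ x ∈ D, Continuous fun t => U t x) (x : X) :
    Continuous fun t => U t x := by
  refine continuous_of_uniform_approx_of_continuous fun u hu => ?_
  obtain ⟨ε, hε, hεu⟩ := Metric.mem_uniformity_dist.1 hu
  obtain ⟨d, hdD, hd⟩ := hD.exists_dist_lt x hε
  refine ⟨fun t => U t d, hc d hdD, fun t => hεu ?_⟩
  rw [dist_eq_norm, ← map_sub, hU, ← dist_eq_norm]
  exact hd

variable [CompleteSpace X]

/-- Isometries that converge strongly on a dense set converge strongly. -/
theorem exists_tendsto_of_dense_of_norm_map {V : ℕ → X →L[ℝ] X} (hV : ∀ n x, ‖V n x‖ = ‖x‖)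
    {D : Set X} (hD : Dense D) (hc : ∀ x ∈ D, CauchySeq fun n => V n x) (x : X) :
    ∃ y, Tendsto (fun n => V n x) atTop (𝓝 y) := by
  refine cauchySeq_tendsto_of_complete (Metric.cauchySeq_iff.2 fun ε hε => ?_)
  obtain ⟨d, hdD, hd⟩ := hD.exists_dist_lt x (by positivity : 0 < ε / 3)
  obtain ⟨N, hN⟩ := Metric.cauchySeq_iff.1 (hc d hdD) (ε / 3) (by positivity)
  refine ⟨N, fun m hm n hn => ?_⟩
  have hk : ∀ k, dist (V k x) (V k d) < ε / 3 := fun k => by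
    rw [dist_eq_norm, ← map_sub, hV, ← dist_eq_norm]; exact hd
  have h1 := dist_triangle4 (V m x) (V m d) (V n d) (V n x)
  have h2 := hN m hm n hn
  have h3 := hk n
  rw [dist_comm] at h3
  linarith [hk m]

/-- An injective bounded skew-adjoint `T` yields a strongly continuous isometric group `G` that
commutes with `T` and satisfies `G t (T y) - T y = ∫ s in 0..t, G s y`. -/
theorem exists_isometryGroup_of_inverse {T : X →L[ℝ] X} (hT : star T = -T)
    (hinj : ∀ y, T y = 0 → y = 0) :
    ∃ G : C0Group X, (∀ t x, ‖G.toFun t x‖ = ‖x‖) ∧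
      (∀ t x, T (G.toFun t x) = G.toFun t (T x)) ∧
      ∀ t y, G.toFun t (T y) - T y = ∫ s in (0 : ℝ)..t, G.toFun s y := by
  set ε : ℕ → ℝ := fun n => 1 / ((n : ℝ) + 1) with hε
  have hεpos : ∀ n, 0 < ε n := fun n => Nat.one_div_pos_of_nat
  have hεlim : Tendsto ε atTop (𝓝 0) := tendsto_one_div_add_atTop_nhds_zero_nat
  choose B hB hBcomm hBapprox using fun n => exists_skew_approx hT (hεpos n)
  have hBT : ∀ n, Commute T (B n) := fun n => hBcomm n T (Commute.refl T)
  have hBB : ∀ m n, Commute (B m) (B n) := fun m n => hBcomm n (B m) (hBT m).symm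
  set V : ℕ → ℝ → X →L[ℝ] X := fun n t => NormedSpace.exp (t • B n) with hVdef
  have hV : ∀ n t x, ‖V n t x‖ = ‖x‖ := fun n t x => norm_exp_skew_apply (hB n) t x
  have hVT : ∀ n t x, T (V n t x) = V n t (T x) := fun n t x => by
    have : Commute T (V n t) := ((hBT n).smul_right t).exp_right
    rw [← mul_apply_eq_comp, this.eq, mul_apply_eq_comp]
  have hdT : DenseRange T := dense_range_of_skew_of_injective hT hinj
  have hdT2 : DenseRange fun z => T (T z) := hdT.comp hdT T.continuous
  have hdT3 : DenseRange fun z => T (T (T z)) := hdT.comp hdT2 T.continuous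
  have hBlim : ∀ z, Tendsto (fun n => B n (T (T (T z)))) atTop (𝓝 (T (T z))) := by
    intro z
    rw [tendsto_iff_norm_sub_tendsto_zero]
    refine squeeze_zero (fun n => norm_nonneg _) (fun n => hBapprox n z) ?_
    have := (hεlim.const_mul 2).mul_const ‖z‖
    simpa using this
  have hcauchy : ∀ t, ∀ x ∈ range (fun z => T (T (T z))), CauchySeq fun n => V n t x := by
    rintro t _ ⟨z, rfl⟩
    rw [Metric.cauchySeq_iff]
    intro δ hδ
    obtain ⟨N, hN⟩ := Metric.cauchySeq_iff.1 (hBlim z).cauchySeq (δ / (|t| + 1)) (by positivity)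
    refine ⟨N, fun m hm n hn => ?_⟩
    have h1 := norm_exp_skew_sub_exp_skew_le (hB m) (hB n) (hBB m n) t (T (T (T z)))
    have h2 := hN m hm n hn
    rw [dist_eq_norm] at h2 ⊢
    refine h1.trans_lt ?_
    calc _ ≤ δ / (|t| + 1) * |t| := by gcongr
      _ < δ := by
        rw [div_mul_eq_mul_div, div_lt_iff₀ (by positivity)]
        nlinarith [abs_nonneg t]
  choose W hW using fun t x =>
    exists_tendsto_of_dense_of_norm_map (V := fun n => V n t) (fun n x => hV n t x) hdT3
      (hcauchy t) x
  have hWn : ∀ t x, ‖W t x‖ = ‖x‖ := fun t x =>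
    tendsto_nhds_unique (hW t x).norm (by simp only [hV]; exact tendsto_const_nhds)
  let U : ℝ → X →L[ℝ] X := fun t => LinearMap.mkContinuous
    { toFun := W t
      map_add' := fun x y => tendsto_nhds_unique (hW t (x + y))
        (by simp only [map_add]; exact (hW t x).add (hW t y))
      map_smul' := fun c x => tendsto_nhds_unique (hW t (c • x))
        (by simp only [map_smul]; exact (hW t x).const_smul c) } 1
    (fun x => by rw [one_mul]; exact (hWn t x).le)
  have hU : ∀ t x, Tendsto (fun n => V n t x) atTop (𝓝 (U t x)) := hW
  have hUn : ∀ t x, ‖U t x‖ = ‖x‖ := hWn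
  -- Strong convergence of isometries allows a moving argument, as needed for the group law and for
  -- the integrands below.
  have hVU : ∀ t (x : ℕ → X) y, Tendsto x atTop (𝓝 y) →
      Tendsto (fun n => V n t (x n)) atTop (𝓝 (U t y)) := by
    intro t x y hxy
    have h1 : Tendsto (fun n => V n t (x n - y)) atTop (𝓝 0) := by
      rw [tendsto_zero_iff_norm_tendsto_zero]
      simp only [hV]
      exact tendsto_iff_norm_sub_tendsto_zero.1 hxy
    simpa using h1.add (hU t y)
  have hUcont : ∀ x, Continuous fun t => U t x := by
    refine continuous_of_dense_of_norm_map hUn hdT3 ?_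
    rintro _ ⟨z, rfl⟩
    have : LipschitzWith ‖T (T z)‖₊ fun t => U t (T (T (T z))) := by
      refine LipschitzWith.of_dist_le_mul fun t s => ?_
      rw [dist_eq_norm, Real.dist_eq, coe_nnnorm]
      exact le_of_tendsto_of_tendsto' ((hU t _).sub (hU s _)).norm
        ((hBlim z).norm.mul_const |t - s|)
        fun n => norm_exp_skew_apply_sub_le (hB n) s t _
    exact this.continuous
  refine ⟨⟨U, ?_, ?_, hUcont⟩, hUn, ?_, ?_⟩
  · ext x
    refine tendsto_nhds_unique (hU 0 x) ?_
    simp [hVdef]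
  · intro s t
    ext x
    refine tendsto_nhds_unique (hU (s + t) x) ?_
    have := hVU s _ _ (hU t x)
    rw [ContinuousLinearMap.comp_apply]
    simpa only [hVdef, exp_add_smul, mul_apply_eq_comp] using this
  · intro t x
    refine tendsto_nhds_unique ((T.continuous.tendsto _).comp (hU t x)) ?_
    simp only [Function.comp_def, hVT]
    exact hU t (T x)
  · intro t
    have hIcont : Continuous fun y => ∫ s in (0 : ℝ)..t, U s y := by
      have : LipschitzWith (Real.nnabs t) fun y => ∫ s in (0 : ℝ)..t, U s y := by
        refine LipschitzWith.of_dist_le_mul fun y z => ?_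
        rw [dist_eq_norm, dist_eq_norm, ← intervalIntegral.integral_sub
          ((hUcont y).intervalIntegrable _ _) ((hUcont z).intervalIntegrable _ _)]
        refine (intervalIntegral.norm_integral_le_of_norm_le_const (C := ‖y - z‖)
          fun s _ => ?_).trans ?_
        · rw [← map_sub, hUn]
        · rw [sub_zero, mul_comm]; simp
      exact this.continuous
    -- Both sides are continuous in `y`, so `y = T² z` suffices. Then `T y = T³ z` lies where `B n`
    -- converges, and the identity is the limit of the fundamental theorem of calculus for `V n`.
    have hclosed : IsClosed {y | U t (T y) - T y = ∫ s in (0 : ℝ)..t, U s y} :=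
      isClosed_eq (by fun_prop) hIcont
    refine fun y => hdT2.induction_on (p := fun y => U t (T y) - T y = ∫ s in (0 : ℝ)..t, U s y)
      y hclosed fun z => ?_
    refine tendsto_nhds_unique ((hU t (T (T (T z)))).sub_const _) ?_
    have hVcont : ∀ n x, Continuous fun s => V n s x := fun n x =>
      continuous_iff_continuousAt.2 fun s => (hasDerivAt_exp_smul_apply (B n) x s).continuousAt
    have hFTC : ∀ n, V n t (T (T (T z))) - T (T (T z))
        = ∫ s in (0 : ℝ)..t, V n s (B n (T (T (T z)))) := by
      intro n
      rw [intervalIntegral.integral_eq_sub_of_hasDerivAt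
        (fun s _ => hasDerivAt_exp_smul_apply (B n) (T (T (T z))) s)
        ((hVcont n _).intervalIntegrable _ _)]
      simp [hVdef]
    simp only [hFTC]
    obtain ⟨C, hC⟩ := (hBlim z).norm.bddAbove_range
    refine intervalIntegral.tendsto_integral_filter_of_dominated_convergence (fun _ => C)
      (Eventually.of_forall fun n => (hVcont n _).aestronglyMeasurable) ?_
      intervalIntegrable_const ?_
    · refine Eventually.of_forall fun n => Eventually.of_forall fun s _ => ?_
      rw [hV]
      exact hC ⟨n, rfl⟩
    · exact Eventually.of_forall fun s _ => hVU s _ _ (hBlim z)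

theorem generatesIsometryGroup_of_skewSymmetric_of_surjective (A : X →ₗ.[ℝ] X)
    (hs : ∀ x y : A.domain, inner ℝ (A x) (y : X) = -inner ℝ (x : X) (A y))
    (hA : ∀ z, ∃ x : A.domain, A x = z) : GeneratesIsometryGroup A := by
  obtain ⟨T, hT, hgraph⟩ := exists_skew_inverse A hs hA
  have hinj : ∀ y, T y = 0 → y = 0 := by
    intro y hy
    have h1 := (hgraph (T y) y).2 rfl
    rw [hy] at h1
    exact A.graph_fst_eq_zero_snd h1 rfl
  obtain ⟨G, hGn, hGT, hGint⟩ := exists_isometryGroup_of_inverse hT hinj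
  have hG0 : ∀ x, G.toFun 0 x = x := fun x => by rw [G.map_zero]; rfl
  have hderiv : ∀ y, Tendsto (fun t : ℝ => t⁻¹ • (G.toFun t (T y) - T y)) (𝓝[≠] 0) (𝓝 y) := by
    intro y
    have h1 : HasDerivAt (fun t => ∫ s in (0 : ℝ)..t, G.toFun s y) (G.toFun 0 y) 0 :=
      (G.continuous_orbit y).integral_hasStrictDerivAt 0 0 |>.hasDerivAt
    rw [hasDerivAt_iff_tendsto_slope_zero, hG0] at h1
    simpa [hGint] using h1
  refine ⟨G, fun x y => ?_, fun t => AddMonoidHomClass.isometry_of_norm _ (hGn t)⟩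
  rw [hgraph]
  constructor
  · rintro rfl
    exact hderiv y
  -- Applying `T` to the difference quotients of `x` gives those of `T x`. The former tend to `T y`
  -- and the latter to `x`, so `x = T y`.
  · intro h
    refine tendsto_nhds_unique (hderiv x) ?_
    have := (T.continuous.tendsto y).comp h
    simpa only [Function.comp_def, map_smul, map_sub, hGT] using this

end Abstract

/-! ### Absolutely continuous functions on `[0, L]` -/

lemma setIntegral_Ioo_eq {L : ℝ} (hL : 0 < L) (f : ℝ → ℝ) :
    ∫ x in Ioo 0 L, f x = ∫ x in 0..L, f x := by
  rw [intervalIntegral.integral_of_le hL.le, integral_Ioc_eq_integral_Ioo]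

lemma intervalIntegrable_L2 {L : ℝ} (hL : 0 < L) (f : L2 L) : IntervalIntegrable f volume 0 L :=
  (intervalIntegrable_iff_integrableOn_Ioo_of_le hL.le).2
    ((Lp.memLp f).integrable (by norm_num))

/-- `u` is absolutely continuous on `[0, L]` with integrable derivative `v`. -/
def IsPrimitive (L : ℝ) (u v : ℝ → ℝ) : Prop :=
  IntervalIntegrable v volume 0 L ∧ ∀ x ∈ Icc 0 L, u x = u 0 + ∫ s in 0..x, v s

lemma IsPrimitive.of_hasDerivAt {u v : ℝ → ℝ} (L : ℝ) (h : ∀ x, HasDerivAt u (v x) x)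
    (hv : Continuous v) : IsPrimitive L u v := by
  refine ⟨hv.intervalIntegrable _ _, fun x _ => ?_⟩
  rw [intervalIntegral.integral_eq_sub_of_hasDerivAt (fun y _ => h y) (hv.intervalIntegrable _ _)]
  ring

lemma IsPrimitive.congr_ae {L : ℝ} (hL : 0 < L) {u v w : ℝ → ℝ} (h : IsPrimitive L u v)
    (hvw : v =ᵐ[intervalMeasure L] w) : IsPrimitive L u w := by
  have hvw' : v =ᵐ[volume.restrict (Ioc 0 L)] w := by
    rwa [← restrict_Ioo_eq_restrict_Ioc]
  refine ⟨h.1.congr_ae (by rwa [uIoc_of_le hL.le]), fun x hx => ?_⟩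
  rw [h.2 x hx]
  congr 1
  refine intervalIntegral.integral_congr_ae ?_
  filter_upwards [(ae_restrict_iff' measurableSet_Ioc).1 hvw'] with y hy hyx
  rw [uIoc_of_le hx.1] at hyx
  exact hy ⟨hyx.1, hyx.2.trans hx.2⟩

lemma absolutelyContinuousOnInterval_const_add_integral {L c : ℝ} {v : ℝ → ℝ}
    (hv : IntervalIntegrable v volume 0 L) :
    AbsolutelyContinuousOnInterval (fun x => c + ∫ s in 0..x, v s) 0 L :=
  AbsolutelyContinuousOnInterval.add
    (contDiffOn_const (c := c)).absolutelyContinuousOnInterval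
    (hv.absolutelyContinuousOnInterval_intervalIntegral left_mem_uIcc)

lemma IsPrimitive.continuousOn {L : ℝ} (hL : 0 < L) {u v : ℝ → ℝ} (h : IsPrimitive L u v) :
    ContinuousOn u (Icc 0 L) := by
  have := (absolutelyContinuousOnInterval_const_add_integral (c := u 0) h.1).continuousOn
  rw [uIcc_of_le hL.le] at this
  exact this.congr h.2

/-- Integration by parts. -/
lemma IsPrimitive.integral_mul {L : ℝ} (hL : 0 < L) {u u' w w' : ℝ → ℝ}
    (hu : IsPrimitive L u u') (hw : IsPrimitive L w w') :
    ∫ x in 0..L, u' x * w x = u L * w L - u 0 * w 0 - ∫ x in 0..L, u x * w' x := by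
  -- The functions are replaced by `v 0 + ∫ v'`, which equals `v` on `[0, L]` and has derivative
  -- `v'` almost everywhere by Lebesgue differentiation.
  have key : ∀ {v v' : ℝ → ℝ}, IsPrimitive L v v' →
      ∀ᵐ x, x ∈ uIoc 0 L → deriv (fun x => v 0 + ∫ s in 0..x, v' s) x = v' x := by
    intro v v' hv
    filter_upwards [hv.1.ae_hasDerivAt_integral] with x hx hxL
    exact ((hx (uIoc_subset_uIcc hxL) 0 left_mem_uIcc).const_add (v 0)).deriv
  have h := AbsolutelyContinuousOnInterval.integral_mul_deriv_eq_deriv_mul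
    (absolutelyContinuousOnInterval_const_add_integral (c := u 0) hu.1)
    (absolutelyContinuousOnInterval_const_add_integral (c := w 0) hw.1)
  have hmem : ∀ x ∈ uIoc 0 L, x ∈ Icc 0 L := fun x hx => by
    rw [uIoc_of_le hL.le] at hx; exact ⟨hx.1.le, hx.2⟩
  rw [← hu.2 L ⟨hL.le, le_rfl⟩, ← hw.2 L ⟨hL.le, le_rfl⟩] at h
  simp only [intervalIntegral.integral_same, add_zero] at h
  rw [intervalIntegral.integral_congr_ae (g := fun x => u x * w' x),
    intervalIntegral.integral_congr_ae (f := fun x => deriv _ x * _)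
      (g := fun x => u' x * w x)] at h
  · linarith
  · filter_upwards [key hu] with x hx hxL
    rw [hx hxL, ← hw.2 x (hmem x hxL)]
  · filter_upwards [key hw] with x hx hxL
    rw [hx hxL, ← hu.2 x (hmem x hxL)]

/-! ### Test functions -/

lemma IsTestFunction.apply_eq_zero {L x : ℝ} {φ : ℝ → ℝ} (h : IsTestFunction L φ)
    (hx : x ∉ Ioo 0 L) : φ x = 0 :=
  image_eq_zero_of_notMem_tsupport fun hx' => hx (h.2.2 hx')

lemma IsTestFunction.deriv {L : ℝ} {φ : ℝ → ℝ} (h : IsTestFunction L φ) :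
    IsTestFunction L (deriv φ) :=
  ⟨(contDiff_infty_iff_deriv.1 h.1).2, h.2.1.deriv,
    (closure_minimal support_deriv_subset (isClosed_tsupport φ)).trans h.2.2⟩

lemma IsTestFunction.hasDerivAt {L : ℝ} {φ : ℝ → ℝ} (h : IsTestFunction L φ) (x : ℝ) :
    HasDerivAt φ (_root_.deriv φ x) x :=
  ((contDiff_infty_iff_deriv.1 h.1).1 x).hasDerivAt

lemma IsTestFunction.add {L : ℝ} {φ χ : ℝ → ℝ} (h : IsTestFunction L φ)
    (h' : IsTestFunction L χ) : IsTestFunction L (φ + χ) :=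
  ⟨h.1.add h'.1, h.2.1.add h'.2.1, (tsupport_add φ χ).trans (union_subset h.2.2 h'.2.2)⟩

lemma IsTestFunction.const_mul {L : ℝ} {φ : ℝ → ℝ} (c : ℝ) (h : IsTestFunction L φ) :
    IsTestFunction L (fun x => c * φ x) :=
  ⟨contDiff_const.mul h.1, h.2.1.mul_left, (tsupport_mul_subset_right).trans h.2.2⟩

lemma exists_isTestFunction_integral_eq_one {L : ℝ} (hL : 0 < L) :
    ∃ ρ, IsTestFunction L ρ ∧ ∫ x in 0..L, ρ x = 1 := by
  obtain ⟨f, hf1, hf2, hf3, hf4, hf5⟩ := exists_contDiff_tsupport_subset (n := ⊤)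
    (Ioo_mem_nhds (half_pos hL) (half_lt_self hL))
  have hf : IsTestFunction L f := ⟨hf3, hf2, hf1⟩
  have hpos : 0 < ∫ x in 0..L, f x := by
    refine intervalIntegral.integral_pos hL hf3.continuous.continuousOn
      (fun x _ => (hf4 ⟨x, rfl⟩).1) ⟨L / 2, ⟨(half_pos hL).le, (half_lt_self hL).le⟩, ?_⟩
    rw [hf5]; exact one_pos
  refine ⟨_, hf.const_mul (∫ x in 0..L, f x)⁻¹, ?_⟩
  rw [intervalIntegral.integral_const_mul, inv_mul_cancel₀ hpos.ne']

lemma IsTestFunction.exists_primitive {L : ℝ} (hL : 0 < L) {χ : ℝ → ℝ} (h : IsTestFunction L χ)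
    (h0 : ∫ x in 0..L, χ x = 0) : ∃ Φ, IsTestFunction L Φ ∧ _root_.deriv Φ = χ := by
  have hc : Continuous χ := h.1.continuous
  set Φ : ℝ → ℝ := fun x => ∫ s in 0..x, χ s with hΦ
  have hd : ∀ x, HasDerivAt Φ (χ x) x := fun x =>
    (hc.integral_hasStrictDerivAt 0 x).hasDerivAt
  have hderiv : _root_.deriv Φ = χ := funext fun x => (hd x).deriv
  -- The midpoint is inserted so that the set is nonempty and has least and greatest elements even
  -- when `χ = 0`.
  have hK : IsCompact (insert (L / 2) (tsupport χ)) := h.2.1.isCompact.insert _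
  have hKsub : insert (L / 2) (tsupport χ) ⊆ Ioo 0 L :=
    insert_subset ⟨half_pos hL, half_lt_self hL⟩ h.2.2
  obtain ⟨α, hαK, hα⟩ := hK.exists_isLeast (insert_nonempty _ _)
  obtain ⟨β, hβK, hβ⟩ := hK.exists_isGreatest (insert_nonempty _ _)
  have hα0 := hKsub hαK
  have hβ0 := hKsub hβK
  have hz : ∀ x, x ∉ Icc α β → χ x = 0 := fun x hx =>
    image_eq_zero_of_notMem_tsupport fun hx' =>
      hx ⟨hα (mem_insert_of_mem _ hx'), hβ (mem_insert_of_mem _ hx')⟩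
  have hsupp : Function.support Φ ⊆ Icc α β := by
    intro x hx
    by_contra hxn
    apply hx
    rcases lt_or_ge x α with hxα | hxα
    · refine (intervalIntegral.integral_congr (g := fun _ => (0 : ℝ)) fun y hy => ?_).trans
        intervalIntegral.integral_zero
      refine hz y fun hy' => ?_
      have : y ≤ max 0 x := hy.2
      rcases le_max_iff.1 this with h1 | h1 <;> linarith [hy'.1, hα0.1]
    · have hxβ : β < x := not_le.1 fun h1 => hxn ⟨hxα, h1⟩
      change ∫ s in 0..x, χ s = 0
      rw [← intervalIntegral.integral_add_adjacent_intervals (hc.intervalIntegrable 0 L)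
        (hc.intervalIntegrable L x), h0, zero_add]
      refine (intervalIntegral.integral_congr (g := fun _ => (0 : ℝ)) fun y hy => ?_).trans
        intervalIntegral.integral_zero
      refine hz y fun hy' => ?_
      have : min L x ≤ y := hy.1
      rcases min_le_iff.1 this with h1 | h1 <;> linarith [hy'.2, hβ0.2]
  have hts : tsupport Φ ⊆ Icc α β := closure_minimal hsupp isClosed_Icc
  refine ⟨Φ, ⟨?_, HasCompactSupport.of_support_subset_isCompact isCompact_Icc hsupp, ?_⟩, hderiv⟩
  · rw [contDiff_infty_iff_deriv, hderiv]
    exact ⟨fun x => (hd x).differentiableAt, h.1⟩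
  · exact hts.trans fun x hx => ⟨hα0.1.trans_le hx.1, hx.2.trans_lt hβ0.2⟩

/-- The du Bois-Reymond lemma. -/
lemma ae_eq_const_of_integral_mul_deriv_eq_zero {L : ℝ} (hL : 0 < L) {h : ℝ → ℝ}
    (hi : IntervalIntegrable h volume 0 L)
    (hz : ∀ φ, IsTestFunction L φ → ∫ x in 0..L, h x * deriv φ x = 0) :
    ∃ c, h =ᵐ[intervalMeasure L] fun _ => c := by
  obtain ⟨ρ, hρ, hρ1⟩ := exists_isTestFunction_integral_eq_one hL
  refine ⟨∫ x in 0..L, h x * ρ x, ?_⟩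
  set c := ∫ x in 0..L, h x * ρ x with hc
  have hmul : ∀ φ, IsTestFunction L φ → IntervalIntegrable (fun x => h x * φ x) volume 0 L :=
    fun φ hφ => hi.mul_continuousOn hφ.1.continuous.continuousOn
  have hI : ∀ φ, IsTestFunction L φ → ∫ x in 0..L, (h x - c) * φ x = 0 := by
    intro φ hφ
    set m := ∫ x in 0..L, φ x with hm
    -- Subtracting `m ρ` makes the mean zero, so the result is the derivative of a test function and
    -- the hypothesis applies.
    have hχ : IsTestFunction L (φ + fun x => -m * ρ x) := hφ.add (hρ.const_mul (-m))
    obtain ⟨Φ, hΦ, hΦd⟩ := hχ.exists_primitive hL (by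
      have : ∫ x in 0..L, (φ + fun x => -m * ρ x) x = ∫ x in 0..L, (φ x + -m * ρ x) := rfl
      rw [this, intervalIntegral.integral_add (hφ.1.continuous.intervalIntegrable _ _)
        ((hρ.const_mul (-m)).1.continuous.intervalIntegrable _ _),
        intervalIntegral.integral_const_mul, hρ1, ← hm]
      ring)
    have h1 := hz Φ hΦ
    rw [hΦd] at h1
    have h2 : ∫ x in 0..L, h x * (φ + fun x => -m * ρ x) x
        = ∫ x in 0..L, (h x * φ x + -m * (h x * ρ x)) := by
      congr 1; ext x; simp only [Pi.add_apply]; ring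
    rw [h2, intervalIntegral.integral_add (hmul φ hφ) ((hmul ρ hρ).const_mul _),
      intervalIntegral.integral_const_mul, ← hc] at h1
    have h3 : ∫ x in 0..L, (h x - c) * φ x = ∫ x in 0..L, (h x * φ x - c * φ x) := by
      congr 1; ext x; ring
    rw [h3, intervalIntegral.integral_sub (hmul φ hφ)
      ((hφ.const_mul c).1.continuous.intervalIntegrable _ _),
      intervalIntegral.integral_const_mul, ← hm]
    linarith
  have hint : IntegrableOn (fun x => h x - c) (Ioo 0 L) :=
    (intervalIntegrable_iff_integrableOn_Ioo_of_le hL.le).1 (hi.sub intervalIntegrable_const)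
  have := isOpen_Ioo.ae_eq_zero_of_integral_contDiff_smul_eq_zero
    (hint.locallyIntegrableOn) (fun φ h1 h2 h3 => by
      have e := hI φ ⟨h1, h2, h3⟩
      rw [← setIntegral_Ioo_eq hL] at e
      rw [← setIntegral_eq_integral_of_forall_compl_eq_zero (s := Ioo 0 L)]
      · simpa only [smul_eq_mul, mul_comm] using e
      · intro x hx
        rw [image_eq_zero_of_notMem_tsupport (fun hx' => hx (h3 hx')), zero_smul])
  filter_upwards [(ae_restrict_iff' measurableSet_Ioo).2 this] with x hx
  linarith

/-! ### Weak derivatives and absolutely continuous representatives -/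

lemma IsPrimitive.integral_mul_iteratedDeriv {L : ℝ} (hL : 0 < L) {u : ℕ → ℝ → ℝ} {φ : ℝ → ℝ}
    (j : ℕ) (hu : ∀ i < j, IsPrimitive L (u i) (u (i + 1))) (hφ : IsTestFunction L φ) :
    ∫ x in 0..L, u 0 x * iteratedDeriv j φ x = (-1) ^ j * ∫ x in 0..L, u j x * φ x := by
  induction j generalizing φ with
  | zero => simp
  | succ j ih =>
    have h1 := (hu j (Nat.lt_succ_self j)).integral_mul hL
      (IsPrimitive.of_hasDerivAt L hφ.hasDerivAt hφ.deriv.1.continuous)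
    rw [hφ.apply_eq_zero (x := L) (by simp), hφ.apply_eq_zero (x := 0) (by simp)] at h1
    rw [iteratedDeriv_succ', ih (fun i hi => hu i (hi.trans (Nat.lt_succ_self j))) hφ.deriv, h1]
    ring

lemma IsWeakDeriv.of_isPrimitive {L : ℝ} (hL : 0 < L) {u : ℕ → ℝ → ℝ} {j : ℕ}
    (hu : ∀ i < j, IsPrimitive L (u i) (u (i + 1))) {f g : L2 L}
    (hf : f =ᵐ[intervalMeasure L] u 0) (hg : g =ᵐ[intervalMeasure L] u j) :
    IsWeakDeriv L j f g := by
  intro φ hφ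
  have e1 : ∫ x in Ioo 0 L, f x * iteratedDeriv j φ x
      = ∫ x in Ioo 0 L, u 0 x * iteratedDeriv j φ x :=
    integral_congr_ae (by filter_upwards [hf] with x hx; rw [hx])
  have e2 : ∫ x in Ioo 0 L, g x * φ x = ∫ x in Ioo 0 L, u j x * φ x :=
    integral_congr_ae (by filter_upwards [hg] with x hx; rw [hx])
  rw [e1, e2, setIntegral_Ioo_eq hL, setIntegral_Ioo_eq hL]
  exact IsPrimitive.integral_mul_iteratedDeriv hL j hu hφ

/-- The difference of `f` and a primitive of `g` annihilates every `φ'`, so it is constant by du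
Bois-Reymond. -/
lemma IsWeakDeriv.exists_isPrimitive {L : ℝ} (hL : 0 < L) {f g : L2 L} (h : IsWeakDeriv L 1 f g) :
    ∃ u, f =ᵐ[intervalMeasure L] u ∧ IsPrimitive L u g := by
  have hg := intervalIntegrable_L2 hL g
  have hf := intervalIntegrable_L2 hL f
  set G : ℝ → ℝ := fun x => ∫ s in 0..x, g s with hG
  have hGp : IsPrimitive L G g := ⟨hg, fun x _ => by simp [hG]⟩
  have hGc : ContinuousOn G (uIcc 0 L) := by
    rw [uIcc_of_le hL.le]; exact hGp.continuousOn hL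
  obtain ⟨c, hc⟩ := ae_eq_const_of_integral_mul_deriv_eq_zero hL (h := fun x => f x - G x)
    (hf.sub hGc.intervalIntegrable) (by
      intro φ hφ
      have h1 := h φ hφ
      rw [setIntegral_Ioo_eq hL, setIntegral_Ioo_eq hL, iteratedDeriv_one] at h1
      have h2 := hGp.integral_mul hL
        (IsPrimitive.of_hasDerivAt L hφ.hasDerivAt hφ.deriv.1.continuous)
      rw [hφ.apply_eq_zero (x := L) (by simp), hφ.apply_eq_zero (x := 0) (by simp)] at h2
      simp only [sub_mul]
      rw [intervalIntegral.integral_sub (hf.mul_continuousOn hφ.deriv.1.continuous.continuousOn)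
        (hGc.intervalIntegrable.mul_continuousOn hφ.deriv.1.continuous.continuousOn)]
      linarith)
  refine ⟨fun x => c + G x, ?_, hg, fun x _ => by simp [hG]⟩
  filter_upwards [hc] with x hx
  linarith

lemma IsWeakDeriv.succ {L : ℝ} {j : ℕ} {f g g' : L2 L} (h : IsWeakDeriv L j f g)
    (h' : IsWeakDeriv L (j + 1) f g') : IsWeakDeriv L 1 g g' := by
  intro φ hφ
  have h1 := h _ hφ.deriv
  have h2 := h' φ hφ
  rw [iteratedDeriv_succ', h1, pow_succ, mul_assoc] at h2
  rw [iteratedDeriv_one, pow_one]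
  exact mul_left_cancel₀ (pow_ne_zero _ (by norm_num)) h2

/-- The representatives can be chosen independently for each order: being a primitive depends on the
derivative only up to null sets. -/
lemma exists_representatives {L : ℝ} (hL : 0 < L) {k : ℕ} {f : L2 L} (hf : f ∈ sobolev L k) :
    ∃ u : ℕ → ℝ → ℝ, (∀ j ≤ k, weakDeriv L j f =ᵐ[intervalMeasure L] u j) ∧
      ∀ j < k, IsPrimitive L (u j) (u (j + 1)) := by
  have h : ∀ j, ∃ u : ℝ → ℝ, weakDeriv L j f =ᵐ[intervalMeasure L] u ∧
      (j < k → IsPrimitive L u (weakDeriv L (j + 1) f)) := by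
    intro j
    by_cases hj : j < k
    · obtain ⟨u, hu, hu'⟩ := IsWeakDeriv.exists_isPrimitive hL
        ((isWeakDeriv_weakDeriv hf hj.le).succ (isWeakDeriv_weakDeriv hf hj))
      exact ⟨u, hu, fun _ => hu'⟩
    · exact ⟨_, EventuallyEq.rfl, fun h => absurd h hj⟩
  choose u hu hu' using h
  exact ⟨u, fun j _ => hu j, fun j hj => (hu' j hj).congr_ae hL (hu (j + 1))⟩

lemma weakDeriv_zero_order {L : ℝ} (f : L2 L) : weakDeriv L 0 f = f :=
  IsWeakDeriv.weakDeriv_eq fun φ _ => by simp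

lemma TraceZero.apply_eq_zero {L p : ℝ} (hL : 0 < L) (hp : p ∈ Icc 0 L) {f : L2 L}
    (h : TraceZero L p f) {u : ℝ → ℝ} (hu : ContinuousOn u (Icc 0 L))
    (hfu : f =ᵐ[intervalMeasure L] u) : u p = 0 := by
  obtain ⟨r, hr, hfr, hrp⟩ := h
  have h1 : u =ᵐ[volume.restrict (Icc 0 L)] r := by
    rw [← restrict_Ioo_eq_restrict_Icc]
    exact hfu.symm.trans hfr
  rw [Measure.eqOn_Icc_of_ae_eq volume hL.ne h1 hu hr hp, hrp]

/-! ### Linear differential equations -/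

/-- Variation of constants: `Y x = R (x - p) (y₀ + ∫ s in p..x, R (p - s) (G s))` with `R t = exp
(tM)`. -/
theorem exists_hasDerivAt_linear {E : Type*} [NormedAddCommGroup E] [NormedSpace ℝ E]
    [CompleteSpace E] (M : E →L[ℝ] E) {G : ℝ → E} (hG : Continuous G) (p : ℝ) (y₀ : E) :
    ∃ Y : ℝ → E, Y p = y₀ ∧ ∀ x, HasDerivAt Y (M (Y x) + G x) x := by
  let _ : NormedAlgebra ℚ (E →L[ℝ] E) := NormedAlgebra.restrictScalars ℚ ℝ _
  set R : ℝ → E →L[ℝ] E := fun t => NormedSpace.exp (t • M) with hR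
  have hRd : ∀ t, HasDerivAt R (M * R t) t := fun t => hasDerivAt_exp_smul_const' (𝕂 := ℝ) M t
  have hRc : Continuous R := continuous_iff_continuousAt.2 fun t => (hRd t).continuousAt
  have hR0 : R 0 = 1 := by simp [hR]
  have hRinv : ∀ t, R t * R (-t) = 1 := fun t => by
    rw [hR]
    simp only
    rw [← NormedSpace.exp_add_of_commute (((Commute.refl M).smul_left t).smul_right (-t)),
      ← add_smul, add_neg_cancel, zero_smul, NormedSpace.exp_zero]
  set I : ℝ → E := fun x => y₀ + ∫ s in p..x, R (-(s - p)) (G s) with hI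
  have hc : Continuous fun s => R (-(s - p)) (G s) :=
    (hRc.comp (by fun_prop)).clm_apply hG
  have hId : ∀ x, HasDerivAt I (R (-(x - p)) (G x)) x := fun x =>
    (hc.integral_hasStrictDerivAt p x).hasDerivAt.const_add y₀
  refine ⟨fun x => R (x - p) (I x), by simp [hI, hR0], fun x => ?_⟩
  have h1 : HasDerivAt (fun x => R (x - p)) (M * R (x - p)) x :=
    (hRd (x - p)).comp_sub_const x p
  have h2 := h1.clm_apply (hId x)
  rwa [mul_apply_eq_comp, ← mul_apply_eq_comp (R (x - p)) (R (-(x - p))), hRinv,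
    one_apply_eq_self] at h2

/-- `u 0` solves `b y'''' = a y'' - y - G`, and `u 1`, `u 2`, `u 3` are its derivatives. -/
structure IsSolution (a b : ℝ) (G : ℝ → ℝ) (u : ℕ → ℝ → ℝ) : Prop where
  deriv_zero : ∀ x, HasDerivAt (u 0) (u 1 x) x
  deriv_one : ∀ x, HasDerivAt (u 1) (u 2 x) x
  deriv_two : ∀ x, HasDerivAt (u 2) (u 3 x) x
  deriv_three : ∀ x, HasDerivAt (u 3) ((a * u 2 x - u 0 x - G x) / b) x

lemma exists_isSolution (a b : ℝ) {G : ℝ → ℝ} (hG : Continuous G) (p α : ℝ) :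
    ∃ u, IsSolution a b G u ∧ u 0 p = 0 ∧ u 1 p = 0 ∧ u 2 p = 0 ∧ u 3 p = α := by
  let M : (ℝ × ℝ × ℝ × ℝ) →L[ℝ] (ℝ × ℝ × ℝ × ℝ) := LinearMap.toContinuousLinearMap
    { toFun := fun y => (y.2.1, y.2.2.1, y.2.2.2, (a * y.2.2.1 - y.1) / b)
      map_add' := fun y z => by
        ext <;> simp only [Prod.fst_add, Prod.snd_add]
        ring
      map_smul' := fun c y => by
        ext <;> simp only [Prod.smul_fst, Prod.smul_snd, smul_eq_mul, RingHom.id_apply]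
        ring }
  obtain ⟨Y, hY0, hY⟩ := exists_hasDerivAt_linear M
    (G := fun x => (0, 0, 0, -G x / b)) (by fun_prop) p (0, 0, 0, α)
  have h0 : ∀ x, HasDerivAt (fun x => (Y x).1) (Y x).2.1 x := fun x => by
    simpa [M] using (hY x).hasFDerivAt.fst.hasDerivAt
  have h1 : ∀ x, HasDerivAt (fun x => (Y x).2.1) (Y x).2.2.1 x := fun x => by
    simpa [M] using (hY x).hasFDerivAt.snd.fst.hasDerivAt
  have h2 : ∀ x, HasDerivAt (fun x => (Y x).2.2.1) (Y x).2.2.2 x := fun x => by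
    simpa [M] using (hY x).hasFDerivAt.snd.snd.fst.hasDerivAt
  have h3 : ∀ x, HasDerivAt (fun x => (Y x).2.2.2)
      ((a * (Y x).2.2.1 - (Y x).1 - G x) / b) x := fun x => by
    refine (hY x).hasFDerivAt.snd.snd.snd.hasDerivAt.congr_deriv ?_
    simp [M]
    ring
  refine ⟨fun n => match n with
    | 0 => fun x => (Y x).1
    | 1 => fun x => (Y x).2.1
    | 2 => fun x => (Y x).2.2.1
    | _ => fun x => (Y x).2.2.2, ⟨h0, h1, h2, h3⟩, ?_⟩
  simp [hY0]

lemma IsSolution.add_const_mul {a b : ℝ} {G G' : ℝ → ℝ} {u u' : ℕ → ℝ → ℝ}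
    (h : IsSolution a b G u) (h' : IsSolution a b G' u') (c : ℝ) :
    IsSolution a b (fun x => G x + c * G' x) (fun n x => u n x + c * u' n x) where
  deriv_zero x := (h.deriv_zero x).add ((h'.deriv_zero x).const_mul c)
  deriv_one x := (h.deriv_one x).add ((h'.deriv_one x).const_mul c)
  deriv_two x := (h.deriv_two x).add ((h'.deriv_two x).const_mul c)
  deriv_three x := ((h.deriv_three x).add ((h'.deriv_three x).const_mul c)).congr_deriv (by ring)

/-! ### Boundary value problem: uniqueness by a multiplier, existence by shooting. -/

lemma hasDerivAt_eq_zero_of_eqOn_zero {p q : ℝ} (hpq : p ≠ q) {f f' : ℝ → ℝ}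
    (hf : ∀ x, HasDerivAt f (f' x) x) (h : ∀ x ∈ uIcc p q, f x = 0) :
    ∀ x ∈ uIcc p q, f' x = 0 := by
  intro x hx
  have hu : UniqueDiffWithinAt ℝ (uIcc p q) x := uniqueDiffOn_Icc (min_lt_max.2 hpq) x hx
  exact hu.eq_deriv _ (hf x).hasDerivWithinAt
    ((hasDerivWithinAt_const x (uIcc p q) (0 : ℝ)).congr h (h x hx))

lemma eq_zero_of_hasDerivAt_nonpos {p q : ℝ} {H H' : ℝ → ℝ}
    (hH : ∀ x, HasDerivAt H (H' x) x) (hH' : ∀ x, H' x ≤ 0) (hp : H p = 0) (hq : H q = 0) :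
    ∀ x ∈ uIcc p q, H x = 0 := by
  have hanti : Antitone H := antitone_of_deriv_nonpos (fun x => (hH x).differentiableAt)
    fun x => by rw [(hH x).deriv]; exact hH' x
  intro x hx
  rcases mem_uIcc.1 hx with hx | hx <;>
    linarith [hanti hx.1, hanti hx.2]

/-- The homogeneous boundary value problem for the once integrated equation has only the trivial
solution. -/
theorem IsSolution.eq_zero_of_boundary {a b c p q : ℝ} (ha : 0 < a) (hb : 0 < b) (hpq : p ≠ q)
    {u : ℕ → ℝ → ℝ} (h : IsSolution a b (fun _ => c) u) (h0p : u 0 p = 0) (h1p : u 1 p = 0)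
    (h2p : u 2 p = 0) (h0q : u 0 q = 0) (h1q : u 1 q = 0) : u 3 p = 0 ∧ c = 0 := by
  set u4 : ℝ → ℝ := fun x => (a * u 2 x - u 0 x - c) / b with hu4
  have hd0 := h.deriv_zero
  have hd1 := h.deriv_one
  have hd2 := h.deriv_two
  have hd3 : ∀ x, HasDerivAt (u 3) (u4 x) x := h.deriv_three
  have hd4 : ∀ x, HasDerivAt u4 ((a * u 3 x - u 1 x) / b) x := fun x =>
    ((((hd2 x).const_mul a).sub (hd0 x)).sub_const c).div_const b
  have hξ : ∀ x, HasDerivAt (fun x => x - q) 1 x := fun x => (hasDerivAt_id x).sub_const q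
  -- Obtained by integrating `(x - q) u (-u' + a u''' - b u⁽⁵⁾) = 0` by parts. The weight `x - q`
  -- makes the quadratic terms in `H'` definite and removes the `u''(q)²` term, about which nothing
  -- is prescribed.
  set H : ℝ → ℝ := fun x => -((x - q) * u 0 x ^ 2 / 2)
    + a * ((x - q) * (u 0 x * u 2 x) - u 0 x * u 1 x - (x - q) * u 1 x ^ 2 / 2)
    - b * ((x - q) * (u 0 x * u4 x) - u 0 x * u 3 x - (x - q) * (u 1 x * u 3 x)
      + 2 * (u 1 x * u 2 x) + (x - q) * u 2 x ^ 2 / 2) with hH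
  have hHd : ∀ x, HasDerivAt H
      (-(u 0 x ^ 2 / 2 + 3 * a / 2 * u 1 x ^ 2 + 5 * b / 2 * u 2 x ^ 2)) x := by
    intro x
    have hx := hξ x
    have e0 := hd0 x
    have e1 := hd1 x
    have e2 := hd2 x
    have e3 := hd3 x
    have e4 := hd4 x
    have t1 := ((hx.mul (e0.pow 2)).div_const 2).neg
    have t2 := (((hx.mul (e0.mul e2)).sub (e0.mul e1)).sub
      ((hx.mul (e1.pow 2)).div_const 2)).const_mul a
    have t3 := (((((hx.mul (e0.mul e4)).sub (e0.mul e3)).sub (hx.mul (e1.mul e3))).add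
      ((e1.mul e2).const_mul 2)).add ((hx.mul (e2.pow 2)).div_const 2)).const_mul b
    refine ((t1.add t2).sub t3).congr_deriv ?_
    simp only [Pi.mul_apply, Pi.pow_apply]
    field_simp
    ring
  have hHz := eq_zero_of_hasDerivAt_nonpos hHd (fun x => by
      have : 0 ≤ u 0 x ^ 2 / 2 + 3 * a / 2 * u 1 x ^ 2 + 5 * b / 2 * u 2 x ^ 2 := by positivity
      linarith)
    (by simp [hH, h0p, h1p, h2p] : H p = 0) (by simp [hH, h0q, h1q] : H q = 0)
  have hz0 : ∀ x ∈ uIcc p q, u 0 x = 0 := by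
    intro x hx
    have e := hasDerivAt_eq_zero_of_eqOn_zero hpq hHd hHz x hx
    have : u 0 x ^ 2 = 0 := by
      have i1 : 0 ≤ 3 * a / 2 * u 1 x ^ 2 := by positivity
      have i2 : 0 ≤ 5 * b / 2 * u 2 x ^ 2 := by positivity
      linarith [sq_nonneg (u 0 x)]
    exact pow_eq_zero_iff (two_ne_zero) |>.1 this
  have hz1 := hasDerivAt_eq_zero_of_eqOn_zero hpq hd0 hz0
  have hz2 := hasDerivAt_eq_zero_of_eqOn_zero hpq hd1 hz1
  have hz3 := hasDerivAt_eq_zero_of_eqOn_zero hpq hd2 hz2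
  have hz4 := hasDerivAt_eq_zero_of_eqOn_zero hpq hd3 hz3
  refine ⟨hz3 p left_mem_uIcc, ?_⟩
  have e := hz4 p left_mem_uIcc
  rw [hu4] at e
  simp only [h2p, h0p, mul_zero, sub_self, zero_sub, div_eq_zero_iff, neg_eq_zero, hb.ne',
    or_false] at e
  exact e

/-- The boundary value problem for the once integrated equation. -/
theorem exists_isSolution_boundary {a b p q : ℝ} (ha : 0 < a) (hb : 0 < b) (hpq : p ≠ q)
    {F : ℝ → ℝ} (hF : Continuous F) :
    ∃ (c : ℝ) (u : ℕ → ℝ → ℝ), IsSolution a b (fun x => F x + c) u ∧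
      u 0 p = 0 ∧ u 1 p = 0 ∧ u 2 p = 0 ∧ u 0 q = 0 ∧ u 1 q = 0 := by
  obtain ⟨w, hw, hw0, hw1, hw2, -⟩ := exists_isSolution a b hF p 0
  obtain ⟨v, hv, hv0, hv1, hv2, hv3⟩ := exists_isSolution a b (continuous_const (y := (0 : ℝ))) p 1
  obtain ⟨z, hz, hz0, hz1, hz2, hz3⟩ := exists_isSolution a b (continuous_const (y := (1 : ℝ))) p 0
  have hker : ∀ α γ : ℝ, α * v 0 q + γ * z 0 q = 0 → α * v 1 q + γ * z 1 q = 0 →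
      α = 0 ∧ γ = 0 := by
    intro α γ e0 e1
    have h1 : IsSolution a b (fun _ => γ) (fun n x => α * v n x + γ * z n x) := by
      refine ⟨fun x => ((hv.deriv_zero x).const_mul α).add ((hz.deriv_zero x).const_mul γ),
        fun x => ((hv.deriv_one x).const_mul α).add ((hz.deriv_one x).const_mul γ),
        fun x => ((hv.deriv_two x).const_mul α).add ((hz.deriv_two x).const_mul γ),
        fun x => (((hv.deriv_three x).const_mul α).add
          ((hz.deriv_three x).const_mul γ)).congr_deriv (by ring)⟩
    have h2 := h1.eq_zero_of_boundary ha hb hpq (by simp [hv0, hz0]) (by simp [hv1, hz1])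
      (by simp [hv2, hz2]) e0 e1
    simp only [hv3, hz3] at h2
    exact ⟨by linarith [h2.1], h2.2⟩
  -- A zero determinant would put `(z 0 q, -v 0 q)` and `(z 1 q, -v 1 q)` in the kernel of the
  -- shooting matrix. All entries would then vanish, putting `(1, 0)` in the kernel as well.
  have hdet : v 0 q * z 1 q - z 0 q * v 1 q ≠ 0 := by
    intro hd
    obtain ⟨k1, k2⟩ := hker (z 0 q) (-v 0 q) (by ring) (by linarith)
    obtain ⟨k3, k4⟩ := hker (z 1 q) (-v 1 q) (by linarith) (by ring)
    have := (hker 1 0 (by linarith) (by linarith)).1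
    exact one_ne_zero this
  set d := v 0 q * z 1 q - z 0 q * v 1 q with hd
  -- Cramer's rule for the two conditions at `q`.
  set α := (z 0 q * w 1 q - w 0 q * z 1 q) / d with hα
  set γ := (w 0 q * v 1 q - v 0 q * w 1 q) / d with hγ
  refine ⟨γ, fun n x => w n x + α * v n x + γ * z n x, ?_, ?_⟩
  · have := (hw.add_const_mul hv α).add_const_mul hz γ
    simpa using this
  · refine ⟨by simp [hw0, hv0, hz0], by simp [hw1, hv1, hz1], by simp [hw2, hv2, hz2], ?_, ?_⟩
    · rw [hα, hγ]; field_simp; rw [hd]; ring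
    · rw [hα, hγ]; field_simp; rw [hd]; ring

/-! ### Skew-symmetry -/

lemma exists_representatives_of_mem_sobolevTwoZero {L : ℝ} (hL : 0 < L) {f : L2 L}
    (hf : f ∈ sobolev L 5) (hf₀ : f ∈ sobolevTwoZero L) :
    ∃ u : ℕ → ℝ → ℝ, (∀ j ≤ 5, weakDeriv L j f =ᵐ[intervalMeasure L] u j) ∧
      (∀ j < 5, IsPrimitive L (u j) (u (j + 1))) ∧
      u 0 0 = 0 ∧ u 0 L = 0 ∧ u 1 0 = 0 ∧ u 1 L = 0 := by
  obtain ⟨u, hu, hup⟩ := exists_representatives hL hf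
  obtain ⟨⟨h1, h2⟩, h3, h4⟩ := hf₀
  refine ⟨u, hu, hup, ?_, ?_, ?_, ?_⟩
  · exact h1.2.apply_eq_zero hL ⟨le_rfl, hL.le⟩ ((hup 0 (by norm_num)).continuousOn hL)
      (hu 0 (by norm_num))
  · exact h2.2.apply_eq_zero hL ⟨hL.le, le_rfl⟩ ((hup 0 (by norm_num)).continuousOn hL)
      (hu 0 (by norm_num))
  · exact h3.2.apply_eq_zero hL ⟨le_rfl, hL.le⟩ ((hup 1 (by norm_num)).continuousOn hL)
      (hu 1 (by norm_num))
  · exact h4.2.apply_eq_zero hL ⟨hL.le, le_rfl⟩ ((hup 1 (by norm_num)).continuousOn hL)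
      (hu 1 (by norm_num))

lemma inner_eq_integral_of_ae_eq {L : ℝ} (hL : 0 < L) {f g : L2 L} {u w : ℝ → ℝ}
    (hf : f =ᵐ[intervalMeasure L] u) (hg : g =ᵐ[intervalMeasure L] w) :
    inner ℝ f g = ∫ x in 0..L, u x * w x := by
  rw [L2.inner_def, ← setIntegral_Ioo_eq hL]
  refine integral_congr_ae ?_
  filter_upwards [hf, hg] with x h1 h2
  rw [h1, h2]
  simp [mul_comm]

/-- The second-derivative conditions sit at opposite ends: the only boundary term surviving the
`H²_0` conditions is `[f'' g'']`, from the fifth-order part, and each end needs one vanishing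
factor. -/
theorem inner_diffOp {a b L : ℝ} (hL : 0 < L) (f g : sobolev L 5)
    (hf₀ : (f : L2 L) ∈ sobolevTwoZero L) (hg₀ : (g : L2 L) ∈ sobolevTwoZero L)
    (hf₂ : TraceZero L 0 (weakDeriv L 2 (f : L2 L)))
    (hg₂ : TraceZero L L (weakDeriv L 2 (g : L2 L))) :
    inner ℝ (diffOp a b L f) (g : L2 L) = -inner ℝ (f : L2 L) (diffOp a b L g) := by
  obtain ⟨u, hu, hup, hu00, hu0L, hu10, hu1L⟩ :=
    exists_representatives_of_mem_sobolevTwoZero hL f.2 hf₀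
  obtain ⟨w, hw, hwp, hw00, hw0L, hw10, hw1L⟩ :=
    exists_representatives_of_mem_sobolevTwoZero hL g.2 hg₀
  have hu20 := hf₂.apply_eq_zero hL ⟨le_rfl, hL.le⟩ ((hup 2 (by norm_num)).continuousOn hL)
    (hu 2 (by norm_num))
  have hw2L := hg₂.apply_eq_zero hL ⟨hL.le, le_rfl⟩ ((hwp 2 (by norm_num)).continuousOn hL)
    (hw 2 (by norm_num))
  have hI : ∀ i j, i ≤ 5 → j ≤ 5 →
      inner ℝ (weakDeriv L i (f : L2 L)) (weakDeriv L j (g : L2 L)) = ∫ x in 0..L, u i x * w j x :=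
    fun i j hi hj => inner_eq_integral_of_ae_eq hL (hu i hi) (hw j hj)
  have ibp : ∀ i j, i < 5 → j < 5 → ∫ x in 0..L, u (i + 1) x * w j x
      = u i L * w j L - u i 0 * w j 0 - ∫ x in 0..L, u i x * w (j + 1) x :=
    fun i j hi hj => (hup i hi).integral_mul hL (hwp j hj)
  have e1 := ibp 0 0 (by norm_num) (by norm_num)
  have e2 := ibp 2 0 (by norm_num) (by norm_num)
  have e3 := ibp 1 1 (by norm_num) (by norm_num)
  have e4 := ibp 0 2 (by norm_num) (by norm_num)
  have e5 := ibp 4 0 (by norm_num) (by norm_num)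
  have e6 := ibp 3 1 (by norm_num) (by norm_num)
  have e7 := ibp 2 2 (by norm_num) (by norm_num)
  have e8 := ibp 1 3 (by norm_num) (by norm_num)
  have e9 := ibp 0 4 (by norm_num) (by norm_num)
  norm_num [hu00, hu0L, hu10, hu1L, hw00, hw0L, hw10, hw1L, hu20, hw2L]
    at e1 e2 e3 e4 e5 e6 e7 e8 e9
  have hd : ∀ h : sobolev L 5, diffOp a b L h = -weakDeriv L 1 (h : L2 L)
      + a • weakDeriv L 3 (h : L2 L) - b • weakDeriv L 5 (h : L2 L) := fun _ => rfl
  rw [hd, hd]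
  conv_lhs => rw [← weakDeriv_zero_order (g : L2 L)]
  conv_rhs => rw [← weakDeriv_zero_order (f : L2 L)]
  simp only [inner_sub_left, inner_add_left,
    inner_neg_left, inner_smul_left, inner_sub_right, inner_add_right, inner_neg_right,
    inner_smul_right, conj_trivial]
  simp only [weakDeriv_zero_order]
  have r1 := hI 1 0 (by norm_num) (by norm_num)
  have r2 := hI 3 0 (by norm_num) (by norm_num)
  have r3 := hI 5 0 (by norm_num) (by norm_num)
  have r4 := hI 0 1 (by norm_num) (by norm_num)
  have r5 := hI 0 3 (by norm_num) (by norm_num)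
  have r6 := hI 0 5 (by norm_num) (by norm_num)
  rw [weakDeriv_zero_order] at r1 r2 r3 r4 r5 r6
  rw [r1, r2, r3, r4, r5, r6, e1, e2, e3, e4, e5, e6, e7, e8, e9]
  ring

/-! ### Surjectivity -/

lemma IsPrimitive.add_const_mul {L : ℝ} {u v w z : ℝ → ℝ} (h : IsPrimitive L u v)
    (h' : IsPrimitive L w z) (k : ℝ) :
    IsPrimitive L (fun x => u x + k * w x) (fun x => v x + k * z x) := by
  refine ⟨h.1.add (h'.1.const_mul k), fun x hx => ?_⟩
  have hsub : uIcc 0 x ⊆ uIcc 0 L := uIcc_subset_uIcc left_mem_uIcc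
    (by rw [uIcc_of_le (hx.1.trans hx.2)]; exact hx)
  rw [intervalIntegral.integral_add (h.1.mono_set hsub) ((h'.1.mono_set hsub).const_mul k),
    intervalIntegral.integral_const_mul]
  simp only
  rw [h.2 x hx, h'.2 x hx]
  ring

/-- Cutting `f` off outside `(0, L)` makes the primitive continuous on all of `ℝ`, as the
differential equation requires. -/
lemma exists_continuous_isPrimitive {L : ℝ} (hL : 0 < L) (f : L2 L) :
    ∃ F : ℝ → ℝ, Continuous F ∧ IsPrimitive L F f := by
  have hint : Integrable ((Ioo 0 L).indicator f) :=
    (integrable_indicator_iff measurableSet_Ioo).2 ((Lp.memLp f).integrable (by norm_num))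
  refine ⟨fun x => ∫ s in 0..x, (Ioo 0 L).indicator f s,
    intervalIntegral.continuous_primitive (fun _ _ => hint.intervalIntegrable) 0, ?_⟩
  have h : IsPrimitive L (fun x => ∫ s in 0..x, (Ioo 0 L).indicator f s) ((Ioo 0 L).indicator f) :=
    ⟨hint.intervalIntegrable, fun x _ => by simp⟩
  refine h.congr_ae hL ?_
  filter_upwards [ae_restrict_mem measurableSet_Ioo] with x hx
  rw [indicator_of_mem hx]

lemma memLp_of_continuous {L : ℝ} {u : ℝ → ℝ} (hu : Continuous u) :
    MemLp u 2 (intervalMeasure L) := by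
  obtain ⟨C, hC⟩ := (isCompact_Icc (a := 0) (b := L)).exists_bound_of_continuousOn hu.continuousOn
  refine MemLp.of_bound hu.aestronglyMeasurable C ?_
  filter_upwards [ae_restrict_mem measurableSet_Ioo] with x hx
  exact hC x (Ioo_subset_Icc_self hx)

theorem exists_diffOp_eq {a b L p q : ℝ} (ha : 0 < a) (hb : 0 < b) (hL : 0 < L)
    (hpq : p = 0 ∧ q = L ∨ p = L ∧ q = 0) (f : L2 L) :
    ∃ w : sobolev L 5, (w : L2 L) ∈ sobolevTwoZero L ∧
      TraceZero L p (weakDeriv L 2 (w : L2 L)) ∧ diffOp a b L w = f := by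
  obtain ⟨F, hFc, hF⟩ := exists_continuous_isPrimitive hL f
  have hne : p ≠ q := by
    rcases hpq with ⟨rfl, rfl⟩ | ⟨rfl, rfl⟩
    · exact hL.ne
    · exact hL.ne'
  obtain ⟨c, u, hu, hu0p, hu1p, hu2p, hu0q, hu1q⟩ := exists_isSolution_boundary ha hb hne hFc
  have hc : ∀ {v v' : ℝ → ℝ}, (∀ x, HasDerivAt v (v' x) x) → Continuous v := fun h =>
    continuous_iff_continuousAt.2 fun x => (h x).continuousAt
  have c0 := hc hu.deriv_zero
  have c1 := hc hu.deriv_one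
  have c2 := hc hu.deriv_two
  have c3 := hc hu.deriv_three
  -- The solution and its derivatives up to order five. The fourth is read off the equation and is
  -- only absolutely continuous on `[0, L]`; the fifth contains `f` and is only in `L²`.
  set U : ℕ → ℝ → ℝ := fun n => match n with
    | 0 => u 0
    | 1 => u 1
    | 2 => u 2
    | 3 => u 3
    | 4 => fun x => (a * u 2 x - u 0 x - (F x + c)) / b
    | _ => fun x => (a * u 3 x - u 1 x) / b + -b⁻¹ * f x with hU
  have c4 : Continuous (U 4) := by
    change Continuous fun x => (a * u 2 x - u 0 x - (F x + c)) / b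
    fun_prop
  have hprim : ∀ j < 5, IsPrimitive L (U j) (U (j + 1)) := by
    intro j hj
    interval_cases j
    · exact IsPrimitive.of_hasDerivAt L hu.deriv_zero c1
    · exact IsPrimitive.of_hasDerivAt L hu.deriv_one c2
    · exact IsPrimitive.of_hasDerivAt L hu.deriv_two c3
    · exact IsPrimitive.of_hasDerivAt L hu.deriv_three c4
    · have h1 : IsPrimitive L (fun x => (a * u 2 x - u 0 x - c) / b)
          (fun x => (a * u 3 x - u 1 x) / b) :=
        IsPrimitive.of_hasDerivAt L (fun x => ((((hu.deriv_two x).const_mul a).sub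
          (hu.deriv_zero x)).sub_const c).div_const b) (by fun_prop)
      have h2 := h1.add_const_mul hF (-b⁻¹)
      convert h2 using 1
      · ext x
        change (a * u 2 x - u 0 x - (F x + c)) / b = _
        ring
      · rfl
  have hmem : ∀ j ≤ 5, MemLp (U j) 2 (intervalMeasure L) := by
    intro j hj
    interval_cases j
    · exact memLp_of_continuous c0
    · exact memLp_of_continuous c1
    · exact memLp_of_continuous c2
    · exact memLp_of_continuous c3
    · exact memLp_of_continuous c4
    · exact (memLp_of_continuous (by fun_prop :
        Continuous fun x => (a * u 3 x - u 1 x) / b)).add ((Lp.memLp f).const_mul (-b⁻¹))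
  have hw : ∀ j (hj : j ≤ 5), IsWeakDeriv L j ((hmem 0 (by norm_num)).toLp (U 0))
      ((hmem j hj).toLp (U j)) := fun j hj =>
    IsWeakDeriv.of_isPrimitive hL (fun i hi => hprim i (hi.trans_le hj))
      (MemLp.coeFn_toLp _) (MemLp.coeFn_toLp _)
  set g : L2 L := (hmem 0 (by norm_num)).toLp (U 0) with hg
  have hg5 : g ∈ sobolev L 5 := fun j hj => ⟨_, hw j hj⟩
  have hg2 : g ∈ sobolev L 2 := fun j hj => hg5 j (hj.trans (by norm_num))
  have hae : ∀ j ≤ 5, weakDeriv L j g =ᵐ[intervalMeasure L] U j := fun j hj => by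
    rw [(hw j hj).weakDeriv_eq]
    exact MemLp.coeFn_toLp _
  have htrace : ∀ j < 5, ∀ r, U j r = 0 → TraceZero L r (weakDeriv L j g) := fun j hj r hr =>
    ⟨U j, (hprim j hj).continuousOn hL, hae j hj.le, hr⟩
  refine ⟨⟨g, hg5⟩, ?_, htrace 2 (by norm_num) p hu2p, ?_⟩
  · have h0 : U 0 0 = 0 ∧ U 0 L = 0 ∧ U 1 0 = 0 ∧ U 1 L = 0 := by
      rcases hpq with ⟨rfl, rfl⟩ | ⟨rfl, rfl⟩
      · exact ⟨hu0p, hu0q, hu1p, hu1q⟩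
      · exact ⟨hu0q, hu0p, hu1q, hu1p⟩
    exact ⟨⟨⟨hg2, htrace 0 (by norm_num) 0 h0.1⟩, ⟨hg2, htrace 0 (by norm_num) L h0.2.1⟩⟩,
      ⟨hg2, htrace 1 (by norm_num) 0 h0.2.2.1⟩, ⟨hg2, htrace 1 (by norm_num) L h0.2.2.2⟩⟩
  · change -weakDeriv L 1 g + a • weakDeriv L 3 g - b • weakDeriv L 5 g = f
    refine Lp.ext ?_
    filter_upwards [Lp.coeFn_sub (-weakDeriv L 1 g + a • weakDeriv L 3 g) (b • weakDeriv L 5 g),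
      Lp.coeFn_add (-weakDeriv L 1 g) (a • weakDeriv L 3 g), Lp.coeFn_neg (weakDeriv L 1 g),
      Lp.coeFn_smul a (weakDeriv L 3 g), Lp.coeFn_smul b (weakDeriv L 5 g),
      hae 1 (by norm_num), hae 3 (by norm_num), hae 5 (by norm_num)] with x k1 k2 k3 k4 k5 k6 k7 k8
    rw [k1, Pi.sub_apply, k2, Pi.add_apply, k3, Pi.neg_apply, k4, Pi.smul_apply, k5,
      Pi.smul_apply, k6, k7, k8]
    change -u 1 x + a • u 3 x - b • ((a * u 3 x - u 1 x) / b + -b⁻¹ * f x) = f x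
    simp only [smul_eq_mul]
    field_simp
    ring

/-! ### The coupled operator on the product space. -/

theorem opA_skewSymmetric {a b L : ℝ} (hL : 0 < L) (x y : (opA a b L).domain) :
    inner ℝ (opA a b L x) (y : X0 L) = -inner ℝ (x : X0 L) (opA a b L y) := by
  obtain ⟨x, ⟨⟨hx1, hx2⟩, hx3⟩, ⟨hx4, hx5⟩, hx6⟩ := x
  obtain ⟨y, ⟨⟨hy1, hy2⟩, hy3⟩, ⟨hy4, hy5⟩, hy6⟩ := y
  rw [WithLp.prod_inner_apply, WithLp.prod_inner_apply, neg_add_rev]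
  -- The swap of components always pairs a first component (condition at `0`) with a second one
  -- (condition at `L`).
  have h1 := inner_diffOp (a := a) (b := b) hL ⟨x.fst, hx1⟩ ⟨y.snd, hy4⟩ hx2 hy5 hx3.2 hy6.2
  have h2 := inner_diffOp (a := a) (b := b) hL ⟨y.fst, hy1⟩ ⟨x.snd, hx4⟩ hy2 hx5 hy3.2 hx6.2
  rw [real_inner_comm, real_inner_comm (diffOp a b L ⟨x.snd, hx4⟩)] at h2
  change inner ℝ (diffOp a b L ⟨x.snd, hx4⟩) y.fst + inner ℝ (diffOp a b L ⟨x.fst, hx1⟩) y.snd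
    = -inner ℝ x.snd (diffOp a b L ⟨y.fst, hy1⟩) + -inner ℝ x.fst (diffOp a b L ⟨y.snd, hy4⟩)
  linarith

theorem opA_surjective {a b L : ℝ} (ha : 0 < a) (hb : 0 < b) (hL : 0 < L) (z : X0 L) :
    ∃ x : (opA a b L).domain, opA a b L x = z := by
  obtain ⟨φ, hφ, hφ2, hφz⟩ := exists_diffOp_eq ha hb hL (Or.inl ⟨rfl, rfl⟩) z.snd
  obtain ⟨ψ, hψ, hψ2, hψz⟩ := exists_diffOp_eq ha hb hL (Or.inr ⟨rfl, rfl⟩) z.fst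
  refine ⟨⟨WithLp.toLp 2 ((φ : L2 L), (ψ : L2 L)),
    ⟨⟨φ.2, hφ⟩, φ.2, hφ2⟩, ⟨ψ.2, hψ⟩, ψ.2, hψ2⟩, ?_⟩
  change WithLp.toLp 2 (diffOp a b L ψ, diffOp a b L φ) = z
  rw [hφz, hψz]
  rfl

end Boussinesq

end

theorem proposition2p4 (a b L : ℝ) (ha : 0 < a) (hb : 0 < b) (hL : 0 < L) :
    Boussinesq.IsSkewAdjointOp (Boussinesq.opA a b L) ∧
      Boussinesq.GeneratesIsometryGroup (Boussinesq.opA a b L) :=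
  ⟨Boussinesq.isSkewAdjointOp_of_skewSymmetric_of_surjective _
      (Boussinesq.opA_skewSymmetric hL) (Boussinesq.opA_surjective ha hb hL),
    Boussinesq.generatesIsometryGroup_of_skewSymmetric_of_surjective _
      (Boussinesq.opA_skewSymmetric hL) (Boussinesq.opA_surjective ha hb hL)⟩
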